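/- **Setting.** Let $A$ be a finite non-empty alphabet, $\mathrm M(A)$ the set of words over $A$, $\ell(v)$ the length of a word $v$, and $T^c(A)$ the shuffle Hopf algebra (the real vector space spanned by $\mathrm M(A)$, with the shuffle product, the deconcatenation coproduct, the counit $\varepsilon$, and the antipode $S(a_1\cdots a_n)=(-1)^na_n\cdots a_1$). The dual of $T^c(A)$ carries the convolution product $\langle f\star g,v\rangle=\sum_{v=uw}\langle f,u\rangle\langle g,w\rangle$; $\exp$ and $\log$ are the corresponding power series, and $\mathrm{BCH}(\alpha,\beta)=\log(\exp(\alpha)\star\exp(\beta))$. For exponents $\gamma=(\gamma_a)_{a\in A}$ in $(0,1)$ put $\hat\gamma=\min_a\gamma_a$ and $\omega(a_1\cdots a_k)=(\gamma_{a_1}+\dots+\gamma_{a_k})/\hat\gamma$, let $\mathbf L$ be the finite set of words with $\omega(v)\le\hat\gamma^{-1}$, let $\mathcal H_{\mathrm a}(A)$ be the subcoalgebra spanned by $\mathbf L$, and let $\mathcal H_{\mathrm a}(A)^*$ be its dual algebra (functionals on it are extended by $0$ to words outside $\mathbf L$). Let $\mathfrak g_{\mathrm a}(A)$ be the space of infinitesimal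 characters on $\mathcal H_{\mathrm a}(A)$, i.e. $\langle\alpha,uv\rangle=\langle\alpha,u\rangle\langle\varepsilon,v\rangle+\langle\varepsilon,u\rangle\langle\alpha,v\rangle$ for the shuffle product, and let $G_{\mathrm a}(A)=\exp(\mathfrak g_{\mathrm a}(A))$. An *anisotropic geometric $\gamma$-rough path* is a map $X:[0,1]^2\to G_{\mathrm a}(A)$ with $X_{tt}=\varepsilon$, $X_{su}\star X_{ut}=X_{st}$ for all $s,u,t\in[0,1]$, and, for every $v\in\mathbf L$, $|\langle X_{st},v\rangle|\le C_v|t-s|^{\hat\gamma\omega(v)}$ for all $s,t\in[0,1]$ with some constant $C_v$. It is *over* $(x^a)_{a\in A}$ if $\langle X_{st},a\rangle=x^a_t-x^a_s$ for all $a\in A$ and $s,t\in[0,1]$. **The construction.** Let $x^a:[0,1]\to\mathbb R$ be $\gamma_a$-Hölder. Paths $\mathbb X^n$ on $[0,1]$ with values in functionals on the span of the words $v\in\mathbf L$ with $\ell(v)\le n$ are defined as follows. $\mathbb X^1_t=\varepsilon+\sum_{a\in A}(x^a_t-x^a_0)\,a$, where $a$ also denotes the functional dual to the one-letter word $a$.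 Given $\mathbb X^n$, let $X^n_{st}=(\mathbb X^n_s)^{-1}\star\mathbb X^n_t$ and $L_{st}=\log X^n_{st}$ at level $n$ (that is, on words of length at most $n$ in $\mathbf L$, extended by $0$), where the inverse of $X$ is $X\circ S$. With $t^m_k=k2^{-m}$, put $Z_{0,1}=0$ and, for $m\ge1$ and $0\le k<2^{m-1}$, $$Z_{t^m_{2k},t^m_{2k+1}}=Z_{t^m_{2k+1},t^m_{2k+2}}=\tfrac12Z_{t^{m-1}_k,t^{m-1}_{k+1}}-\tfrac12\mathrm{BCH}_{(n+1)}\bigl(L_{t^m_{2k},t^m_{2k+1}},L_{t^m_{2k+1},t^m_{2k+2}}\bigr),$$ where $\mathrm{BCH}_{(n+1)}$ is the restriction of $\mathrm{BCH}$ to the words of length $n+1$ in $\mathbf L$. Put $Y_{t^m_k,t^m_{k+1}}=\exp(L_{t^m_k,t^m_{k+1}}+Z_{t^m_k,t^m_{k+1}})$ at level $n+1$. Then $\mathbb X^{n+1}$ takes the value $Y_{t^m_0,t^m_1}\star\cdots\star Y_{t^m_{j-1},t^m_j}$ (at level $n+1$) at $t^m_j$, and is extended to $[0,1]$ by continuity,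 $\mathbb X^{n+1}_t=\lim_{m\to\infty}\mathbb X^{n+1}_{\lfloor 2^mt\rfloor2^{-m}}$. The *rough path constructed over* $(x^a)_{a\in A}$ *with exponents* $\gamma$ is $X_{st}=(\mathbb X^N_s)^{-1}\star\mathbb X^N_t$, with $N=\lfloor\hat\gamma^{-1}\rfloor$ and the product of $\mathcal H_{\mathrm a}(A)^*$. **Statement.** Let $(\gamma_a)_{a\in A}$ be in $(0,1)$ and let $x^a$ be $\gamma_a$-Hölder on $[0,1]$ for $a\in A$. Let $b\notin A$ be a new letter, $A^0=A\cup\{b\}$, let $\gamma_b\in(0,1)$ be such that $\sum_{a\in A^0}k_a\gamma_a\ne1$ for all $(k_a)\in\{0,1,2,\dots\}^{A^0}$, and let $x^b$ be $\gamma_b$-Hölder on $[0,1]$. Let $X$ be the rough path constructed over $(x^a)_{a\in A}$ with exponents $(\gamma_a)_{a\in A}$, and $X^0$ the one constructed over $(x^a)_{a\in A^0}$ with exponents $(\gamma_a)_{a\in A^0}$. Then $X$ and $X^0$ are well defined anisotropic geometric rough paths on $G_{\mathrm a}(A)$ and $G_{\mathrm a}(A^0)$ over $(x^a)_{a\in A}$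 and $(x^a)_{a\in A^0}$, respectively, and the restriction of $X^0$ to words from $\mathrm M(A)$ coincides with $X$: $$\langle X^0_{st},v\rangle=\langle X_{st},v\rangle\qquad\text{for all }s,t\in[0,1],\ v\in\mathrm M(A).$$ -/

import Mathlib

open Set Filter Topology

namespace AnisoRP

noncomputable section

/-! ### The shuffle Hopf algebra on words and its dual -/

/-- The algebraic dual of `T^c(A)`, the vector space spanned by the words over the alphabet `A`:
a linear functional is given by its values on the basis of words. -/
abbrev Dual (A : Type*) := List A → ℝ

/-- All shuffles of two words, counted with multiplicity. -/
def shuffle {A : Type*} : List A → List A → List (List A)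
  | [], v => [v]
  | a :: u, [] => [a :: u]
  | a :: u, b :: v =>
      (shuffle u (b :: v)).map (fun w => a :: w) ++ (shuffle (a :: u) v).map (fun w => b :: w)
  termination_by u v => u.length + v.length

/-- The pairing `⟨f, u ⧢ v⟩` of a functional with the shuffle product of two words. -/
def pairShuffle {A : Type*} (f : Dual A) (u v : List A) : ℝ := ((shuffle u v).map f).sum

/-- The counit `ε`. -/
def counit {A : Type*} : Dual A
  | [] => 1
  | _ :: _ => 0

/-- The convolution product `f ⋆ g`, dual to the deconcatenation of words. -/
def conv {A : Type*} (f g : Dual A) : Dual A := fun v =>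
  ∑ i ∈ Finset.range (v.length + 1), f (v.take i) * g (v.drop i)

/-- The powers `f^{⋆ k}`. -/
def convPow {A : Type*} (f : Dual A) : ℕ → Dual A
  | 0 => counit
  | k + 1 => conv f (convPow f k)

/-- The exponential series `∑ α^{⋆ k} / k!`. If `α` vanishes on the empty word, then the terms with
`k > ℓ(v)` vanish on the word `v`. -/
def expS {A : Type*} (α : Dual A) : Dual A := fun v =>
  ∑ k ∈ Finset.range (v.length + 1), convPow α k v / (k.factorial : ℝ)

/-- The logarithm series `∑_{k ≥ 1} (-1)^{k+1} (X - ε)^{⋆ k} / k`. If `X` is `1` on the empty word,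
then the terms with `k > ℓ(v)` vanish on the word `v`. -/
def logS {A : Type*} (X : Dual A) : Dual A := fun v =>
  ∑ k ∈ Finset.Icc 1 v.length, (-1 : ℝ) ^ (k + 1) * convPow (X - counit) k v / (k : ℝ)

/-- The convolution inverse `X ∘ S` of a character `X`, where `S` is the antipode
`S(a₁ ⋯ aₙ) = (-1)ⁿ aₙ ⋯ a₁`. -/
def inv {A : Type*} (X : Dual A) : Dual A := fun v => (-1 : ℝ) ^ v.length * X v.reverse

/-- Infinitesimal characters of the shuffle algebra. -/
def IsInfChar {A : Type*} (α : Dual A) : Prop :=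
  ∀ u v : List A, pairShuffle α u v = α u * counit v + counit u * α v

/-! ### Weights and the anisotropic truncation -/

/-- The smallest exponent. -/
def gammaHat {A : Type*} (γ : A → ℝ) : ℝ := ⨅ a, γ a

/-- The weight `ω(a₁ ⋯ a_k) = (γ_{a₁} + ⋯ + γ_{a_k}) / γ̂`. -/
def weight {A : Type*} (γ : A → ℝ) (v : List A) : ℝ := (v.map γ).sum / gammaHat γ

/-- The set of words `v` with `ω(v) ≤ γ̂⁻¹`. -/
def lightWords {A : Type*} (γ : A → ℝ) : Set (List A) := {v | weight γ v ≤ (gammaHat γ)⁻¹}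

/-- The words of length at most `n` in `lightWords γ`. -/
def lightWordsUpTo {A : Type*} (γ : A → ℝ) (n : ℕ) : Set (List A) :=
  {v | v ∈ lightWords γ ∧ v.length ≤ n}

/-- The product of `H_a^*`, the dual of the subcoalgebra spanned by `lightWords γ`. Elements of
`H_a^*` are extended by zero to all words. -/
def starA {A : Type*} (γ : A → ℝ) (f g : Dual A) : Dual A := (lightWords γ).indicator (conv f g)

/-- The Lie algebra `g_a` of infinitesimal characters on `H_a` (extended by zero; as the weight is
additive, the extension by zero is an infinitesimal character of the whole shuffle algebra). -/
def lieA {A : Type*} (γ : A → ℝ) : Set (Dual A) :=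
  {α | IsInfChar α ∧ ∀ v, v ∉ lightWords γ → α v = 0}

/-- The group `G_a = exp(g_a)`, where the exponential is that of the algebra `H_a^*`. -/
def groupA {A : Type*} (γ : A → ℝ) : Set (Dual A) :=
  {X | ∃ α ∈ lieA γ, X = (lightWords γ).indicator (expS α)}

/-- Anisotropic geometric `γ`-rough paths on `[0,1]`. -/
structure IsAGRP {A : Type*} (γ : A → ℝ) (X : ℝ → ℝ → Dual A) : Prop where
  mem_group : ∀ s ∈ Icc (0 : ℝ) 1, ∀ t ∈ Icc (0 : ℝ) 1, X s t ∈ groupA γ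
  diag : ∀ t ∈ Icc (0 : ℝ) 1, X t t = counit
  chen : ∀ s ∈ Icc (0 : ℝ) 1, ∀ u ∈ Icc (0 : ℝ) 1, ∀ t ∈ Icc (0 : ℝ) 1,
    starA γ (X s u) (X u t) = X s t
  bound : ∀ v ∈ lightWords γ, ∃ C : ℝ, ∀ s ∈ Icc (0 : ℝ) 1, ∀ t ∈ Icc (0 : ℝ) 1,
    |X s t v| ≤ C * |t - s| ^ (gammaHat γ * weight γ v)

/-- `X` lies over the paths `x^a`. -/
def IsOver {A : Type*} (X : ℝ → ℝ → Dual A) (x : A → ℝ → ℝ) : Prop :=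
  ∀ s ∈ Icc (0 : ℝ) 1, ∀ t ∈ Icc (0 : ℝ) 1, ∀ a, X s t [a] = x a t - x a s

/-- The alphabet `A ∪ {b}` with a new letter `b` is `Option A`, where `b` is `none`. The family on
`A ∪ {b}` which is `f` on `A` and has the value `fb` at `b`. -/
def addLetter {A β : Type*} (f : A → β) (fb : β) : Option A → β
  | none => fb
  | some a => f a

/-! ### The construction -/

/-- The dyadic point `t^m_k = k 2^{-m}`. -/
def dyad (m k : ℕ) : ℝ := (k : ℝ) / 2 ^ m

/-- The logarithm `L_{st}` of `𝕏_s⁻¹ ⋆ 𝕏_t`, taken at level `n` (words of length at most `n`) and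
extended by zero. -/
def logIncr {A : Type*} (γ : A → ℝ) (n : ℕ) (X : ℝ → Dual A) (s t : ℝ) : Dual A :=
  (lightWordsUpTo γ n).indicator (logS (conv (inv (X s)) (X t)))

/-- The homogeneous part of degree `n` (with respect to the length of words) of
`BCH(α, β) = log(exp α ⋆ exp β)`. -/
def bchHom {A : Type*} (γ : A → ℝ) (n : ℕ) (α β : Dual A) : Dual A :=
  {v | v ∈ lightWords γ ∧ v.length = n}.indicator (logS (conv (expS α) (expS β)))

/-- The correction `Z` on the dyadic interval `[t^m_k, t^m_{k+1}]` used to pass from level `n` to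
level `n + 1`: it is `0` on `[0,1]`, and both halves of a dyadic interval receive half of the value
on that interval minus half of the homogeneous part of degree `n + 1` of the
Baker-Campbell-Hausdorff series. -/
def zCorr {A : Type*} (γ : A → ℝ) (n : ℕ) (X : ℝ → Dual A) : ℕ → ℕ → Dual A
  | 0, _ => 0
  | m + 1, k =>
      (1 / 2 : ℝ) • zCorr γ n X m (k / 2) -
      (1 / 2 : ℝ) • bchHom γ (n + 1)
        (logIncr γ n X (dyad (m + 1) (2 * (k / 2))) (dyad (m + 1) (2 * (k / 2) + 1)))
        (logIncr γ n X (dyad (m + 1) (2 * (k / 2) + 1)) (dyad (m + 1) (2 * (k / 2) + 2)))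

/-- `Y = exp_{n+1}(L + Z)` on the dyadic interval `[t^m_k, t^m_{k+1}]`. -/
def yIncr {A : Type*} (γ : A → ℝ) (n : ℕ) (X : ℝ → Dual A) (m k : ℕ) : Dual A :=
  (lightWordsUpTo γ (n + 1)).indicator
    (expS (logIncr γ n X (dyad m k) (dyad m (k + 1)) + zCorr γ n X m k))

/-- The path at the dyadic point `t^m_j`: the product, at level `n + 1`, of the `Y` over the `j`
first dyadic intervals of length `2^{-m}`. -/
def yPath {A : Type*} (γ : A → ℝ) (n : ℕ) (X : ℝ → Dual A) (m : ℕ) : ℕ → Dual A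
  | 0 => counit
  | j + 1 => (lightWordsUpTo γ (n + 1)).indicator (conv (yPath γ n X m j) (yIncr γ n X m j))

/-- The extension of a path from level `n` to level `n + 1`: the path `yPath` on the dyadics,
extended to `[0,1]` as the limit along the dyadic points `⌊2^m t⌋ 2^{-m}`, which tend to `t`. -/
def extendLevel {A : Type*} (γ : A → ℝ) (n : ℕ) (X : ℝ → Dual A) : ℝ → Dual A := fun t v =>
  limUnder atTop (fun m : ℕ => yPath γ n X m ⌊(2 : ℝ) ^ m * t⌋₊ v)

/-- The path at level `1`. -/
def levelOne {A : Type*} (x : A → ℝ → ℝ) : ℝ → Dual A := fun t v =>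
  match v with
  | [] => 1
  | [a] => x a t - x a 0
  | _ :: _ :: _ => 0

/-- The path at level `n`, for `n ≥ 1` (`ε` for `n = 0`). -/
def levelPath {A : Type*} (γ : A → ℝ) (x : A → ℝ → ℝ) : ℕ → ℝ → Dual A
  | 0 => fun _ => counit
  | 1 => levelOne x
  | n + 2 => extendLevel γ (n + 1) (levelPath γ x (n + 1))

/-- The anisotropic geometric rough path constructed over the paths `x^a` with exponents `γ_a`:
the increments `X_{st} = 𝕏_s⁻¹ ⋆ 𝕏_t` in `G_a` of the path at level `N_a = ⌊γ̂⁻¹⌋`. -/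
def roughPath {A : Type*} (γ : A → ℝ) (x : A → ℝ → ℝ) : ℝ → ℝ → Dual A := fun s t =>
  starA γ (inv (levelPath γ x ⌊(gammaHat γ)⁻¹⌋₊ s)) (levelPath γ x ⌊(gammaHat γ)⁻¹⌋₊ t)

end

end AnisoRP

/-! The construction is purely local in the words. The value of a product, exponential, logarithm or
inverse at `v` uses only subwords of `v` (reversed in the case of the inverse), and a word is light
exactly when its exponents sum to at most 1, a condition independent of `gammaHat`. Restriction to
words over `A` therefore commutes with every stage (`restrict_levelPath`). The two alphabets may
only differ in the level at which the construction stops; a further extension does not change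
shorter words (`levelPath_eqOn`), so this difference is harmless.

The remaining work is that one extension from level `n` to `n + 1` preserves `IsLevelPath`.
Algebraically, the logarithm of a character is an infinitesimal character, and so is the top part of
BCH. Hence each `yIncr` is a character. A functional `Z` living on words of length `n + 1` enters
exponentials and products linearly, so the corrections of the two halves add up to `Z - BCH`, which
is what makes the increments over the halves multiply to the increment over the whole
(`conv_yIncr_yIncr`). The products over dyadic intervals are thus independent of the generation.

Analytically, at a light word with exponent sum `w` the correction satisfies `|Z_{m+1}| ≤ |Z_m|/2 +
O(2^{-mw})`. Non-resonance gives `w < 1`, so `Z` is of order `2^{-mw}` (`halving_bound`). The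
increment at a word of length `n + 1` is additive up to products of values at shorter words, and
chaining carries the estimate from dyadic intervals to all pairs of dyadic points (`chaining_bound`,
`homBound_yPath`). The same estimate gives the limit along dyadic points.

The facts on `expS` and `logS` come from real powers: `X^{⋆t}` is at each word a polynomial in `t`,
so identities for natural `t` hold for all `t`; its derivative at 0 is `logS X`, and its value at 1
yields `expS_logS`. -/

namespace AnisoRP

variable {A : Type*}

/-! ### Convolution -/

@[simp] lemma conv_nil (f g : Dual A) : conv f g [] = f [] * g [] := by
  simp [conv]

/-- Splitting off the first letter in a convolution. -/
lemma conv_cons (f g : Dual A) (a : A) (v : List A) :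
    conv f g (a :: v) = f [] * g (a :: v) + conv (fun w => f (a :: w)) g v := by
  simp only [conv, List.length_cons]
  rw [Finset.sum_range_succ']
  simp [add_comm]

lemma conv_add_left (f f' g : Dual A) : conv (f + f') g = conv f g + conv f' g := by
  ext v; simp [conv, add_mul, Finset.sum_add_distrib]

lemma conv_add_right (f g g' : Dual A) : conv f (g + g') = conv f g + conv f g' := by
  ext v; simp [conv, mul_add, Finset.sum_add_distrib]

lemma conv_smul_left (c : ℝ) (f g : Dual A) : conv (c • f) g = c • conv f g := by
  ext v; simp [conv, Finset.mul_sum, mul_assoc]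

/-- Induction on the word with `f` free, since `conv_cons` replaces the left factor by its shift
along the first letter. -/
lemma conv_assoc (f g h : Dual A) : conv (conv f g) h = conv f (conv g h) := by
  ext v
  induction v generalizing f with
  | nil => simp [mul_assoc]
  | cons a v ih =>
    have e : (fun w => conv f g (a :: w)) =
        f [] • (fun w => g (a :: w)) + conv (fun w => f (a :: w)) g := by
      ext w; simp [conv_cons]
    rw [conv_cons, e, conv_add_left, conv_smul_left, conv_cons f, conv_cons g, ← ih]
    simp only [conv_nil, Pi.add_apply, Pi.smul_apply, smul_eq_mul]
    ring

lemma zero_conv (g : Dual A) : conv 0 g = 0 := by ext v; simp [conv]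

@[simp] lemma counit_conv (f : Dual A) : conv counit f = f := by
  ext v
  cases v with
  | nil => simp [counit]
  | cons a v =>
    have : (fun w => counit (a :: w)) = (0 : Dual A) := rfl
    rw [conv_cons, this, zero_conv]; simp [counit]

@[simp] lemma conv_counit (f : Dual A) : conv f counit = f := by
  ext v
  induction v generalizing f with
  | nil => simp [counit]
  | cons a v ih => rw [conv_cons, ih]; simp [counit]

lemma convPow_nil (f : Dual A) (k : ℕ) : convPow f k [] = f [] ^ k := by
  induction k with
  | zero => simp [convPow, counit]
  | succ k ih => simp [convPow, ih, pow_succ']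

lemma convPow_one (f : Dual A) : convPow f 1 = f := by simp [convPow]

lemma convPow_add (f : Dual A) (m n : ℕ) :
    convPow f (m + n) = conv (convPow f m) (convPow f n) := by
  induction m with
  | zero => simp [convPow]
  | succ m ih => rw [Nat.succ_add, convPow, convPow, ih, conv_assoc]

/-- Each of the `k` factors must take at least one letter. Hence the cut-offs in `expS` and `logS`
discard only zero terms. -/
lemma convPow_eq_zero {f : Dual A} (hf : f [] = 0) {k : ℕ} {v : List A} (hk : v.length < k) :
    convPow f k v = 0 := by
  induction k generalizing v with
  | zero => omega
  | succ k ih =>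
    rw [convPow, conv]
    refine Finset.sum_eq_zero fun i hi => ?_
    rcases Nat.eq_zero_or_pos i with rfl | h0
    · simp [hf]
    · rw [Finset.mem_range] at hi
      rw [ih, mul_zero]
      rw [List.length_drop]; omega

/-! ### Truncation sets -/

/-- Sets of words which are closed under taking parts of words, regardless of order. -/
def IsLowerWords (T : Set (List A)) : Prop := ∀ ⦃u v : List A⦄, u ∈ T → v.Subperm u → v ∈ T

lemma isLowerWords_univ : IsLowerWords (univ : Set (List A)) := fun _ _ _ _ => trivial

namespace IsLowerWords
variable {T : Set (List A)}
lemma take (hT : IsLowerWords T) {v : List A} (hv : v ∈ T) (i : ℕ) : v.take i ∈ T :=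
  hT hv (List.take_sublist i v).subperm

lemma drop (hT : IsLowerWords T) {v : List A} (hv : v ∈ T) (i : ℕ) : v.drop i ∈ T :=
  hT hv (List.drop_sublist i v).subperm

lemma reverse (hT : IsLowerWords T) {v : List A} (hv : v ∈ T) : v.reverse ∈ T :=
  hT hv (List.reverse_perm v).subperm

lemma left (hT : IsLowerWords T) {u v : List A} (hv : u ++ v ∈ T) : u ∈ T :=
  hT hv (List.sublist_append_left u v).subperm

lemma right (hT : IsLowerWords T) {u v : List A} (hv : u ++ v ∈ T) : v ∈ T :=
  hT hv (List.sublist_append_right u v).subperm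

lemma take_append_take (hT : IsLowerWords T) {u v : List A} (h : u ++ v ∈ T) (i j : ℕ) :
    u.take i ++ v.take j ∈ T :=
  hT h ((List.take_sublist i u).append (List.take_sublist j v)).subperm

lemma drop_append_drop (hT : IsLowerWords T) {u v : List A} (h : u ++ v ∈ T) (i j : ℕ) :
    u.drop i ++ v.drop j ∈ T :=
  hT h ((List.drop_sublist i u).append (List.drop_sublist j v)).subperm

end IsLowerWords

/-! ### Identities modulo truncation -/

section Congr
variable {T : Set (List A)}

lemma conv_congr (hT : IsLowerWords T) {f f' g g' : Dual A} (hf : EqOn f f' T)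
    (hg : EqOn g g' T) : EqOn (conv f g) (conv f' g') T := fun v hv =>
  Finset.sum_congr rfl fun i _ => by rw [hf (hT.take hv i), hg (hT.drop hv i)]

lemma convPow_congr (hT : IsLowerWords T) {f f' : Dual A} (hf : EqOn f f' T) (k : ℕ) :
    EqOn (convPow f k) (convPow f' k) T := by
  induction k with
  | zero => exact fun _ _ => rfl
  | succ k ih => exact conv_congr hT hf ih

lemma expS_congr (hT : IsLowerWords T) {f f' : Dual A} (hf : EqOn f f' T) :
    EqOn (expS f) (expS f') T := fun v hv =>
  Finset.sum_congr rfl fun k _ => by rw [convPow_congr hT hf k hv]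

lemma logS_congr (hT : IsLowerWords T) {f f' : Dual A} (hf : EqOn f f' T) :
    EqOn (logS f) (logS f') T := fun v hv =>
  Finset.sum_congr rfl fun k _ => by
    rw [convPow_congr hT (f := f - counit) (f' := f' - counit)
      (fun w hw => by simp [hf hw]) k hv]

lemma inv_congr (hT : IsLowerWords T) {f f' : Dual A} (hf : EqOn f f' T) :
    EqOn (inv f) (inv f') T := fun v hv => by
  simp only [inv]; rw [hf (hT.reverse hv)]

end Congr

@[simp] lemma expS_nil (α : Dual A) : expS α [] = 1 := by simp [expS, convPow, counit]

@[simp] lemma logS_nil (X : Dual A) : logS X [] = 0 := by simp [logS]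

/-! ### Shuffles -/

@[simp] lemma pairShuffle_nil_left (f : Dual A) (v : List A) : pairShuffle f [] v = f v := by
  simp [pairShuffle, shuffle]

@[simp] lemma pairShuffle_nil_right (f : Dual A) (u : List A) : pairShuffle f u [] = f u := by
  cases u <;> simp [pairShuffle, shuffle]

lemma pairShuffle_cons_cons (f : Dual A) (a b : A) (u v : List A) :
    pairShuffle f (a :: u) (b :: v) =
      pairShuffle (fun w => f (a :: w)) u (b :: v) +
      pairShuffle (fun w => f (b :: w)) (a :: u) v := by
  simp [pairShuffle, shuffle, Function.comp_def]

lemma pairShuffle_add (f g : Dual A) (u v : List A) :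
    pairShuffle (f + g) u v = pairShuffle f u v + pairShuffle g u v := by
  exact List.sum_map_add

lemma pairShuffle_smul (c : ℝ) (f : Dual A) (u v : List A) :
    pairShuffle (c • f) u v = c * pairShuffle f u v := by
  exact List.sum_map_mul_left (shuffle u v) f c

lemma pairShuffle_zero (u v : List A) : pairShuffle 0 u v = 0 := by
  simpa using pairShuffle_smul 0 (0 : Dual A) u v

/-- This is why truncation sets are closed under `Subperm` and not merely under subwords: membership
of `u ++ v` then controls every term of the shuffle. -/
lemma perm_of_mem_shuffle {u v w : List A} (h : w ∈ shuffle u v) : w.Perm (u ++ v) := by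
  fun_induction shuffle u v generalizing w with
  | case1 v => simp_all
  | case2 a u => simp_all
  | case3 a u b v ih1 ih2 =>
    simp only [List.mem_append, List.mem_map] at h
    rcases h with ⟨w, hw, rfl⟩ | ⟨w, hw, rfl⟩
    · exact (ih1 hw).cons a
    · exact ((ih2 hw).cons b).trans List.perm_middle.symm

lemma mem_of_mem_shuffle {T : Set (List A)} (hT : IsLowerWords T) {u v w : List A}
    (h : u ++ v ∈ T) (hw : w ∈ shuffle u v) : w ∈ T :=
  hT h (perm_of_mem_shuffle hw).subperm

lemma pairShuffle_congr {f g : Dual A} {u v : List A} (h : ∀ w ∈ shuffle u v, f w = g w) :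
    pairShuffle f u v = pairShuffle g u v := by
  unfold pairShuffle
  rw [List.map_congr_left h]

/-- The shuffle product is compatible with deconcatenation. -/
lemma pairShuffle_conv (f g : Dual A) (u v : List A) :
    pairShuffle (conv f g) u v =
      ∑ i ∈ Finset.range (u.length + 1), ∑ j ∈ Finset.range (v.length + 1),
        pairShuffle f (u.take i) (v.take j) * pairShuffle g (u.drop i) (v.drop j) := by
  have key : ∀ (n : ℕ) (f : Dual A) (u v : List A), u.length + v.length = n →
      pairShuffle (conv f g) u v =
      ∑ i ∈ Finset.range (u.length + 1), ∑ j ∈ Finset.range (v.length + 1),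
        pairShuffle f (u.take i) (v.take j) * pairShuffle g (u.drop i) (v.drop j) := by
    intro n
    induction n with
    | zero =>
      intro f u v h
      obtain rfl : u = [] := List.length_eq_zero_iff.1 (by omega)
      obtain rfl : v = [] := List.length_eq_zero_iff.1 (by omega)
      simp
    | succ n ih =>
      intro f u v h
      match u, v with
      | [], v => simp [conv]
      | a :: u, [] => simp [conv]
      | a :: u, b :: v =>
        have e : ∀ c : A, (fun w => conv f g (c :: w)) =
            f [] • (fun w => g (c :: w)) + conv (fun w => f (c :: w)) g := by
          intro c; ext w; simp [conv_cons]
        rw [pairShuffle_cons_cons, e, e, pairShuffle_add, pairShuffle_add, pairShuffle_smul,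
          pairShuffle_smul, ih _ u (b :: v) (by simp at h ⊢; omega),
          ih _ (a :: u) v (by simp at h ⊢; omega)]
        simp only [List.length_cons]
        -- The pairs with an empty prefix on one side are split off; a shuffle of two non-empty
        -- prefixes begins with `a` or with `b`, which matches the two inductive sums.
        rw [Finset.sum_range_succ' _ (u.length + 1), Finset.sum_range_succ' _ (u.length + 1)]
        simp only [Finset.sum_range_succ' _ (v.length + 1), List.take_succ_cons,
          List.drop_succ_cons, List.take_zero, List.drop_zero, pairShuffle_nil_left,
          pairShuffle_nil_right, pairShuffle_cons_cons f, pairShuffle_cons_cons g, add_mul,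
          Finset.sum_add_distrib]
        ring
  exact key _ f u v rfl

/-! ### Characters and infinitesimal characters -/

/-- Characters of the shuffle algebra, truncated to a set of words. -/
structure IsCharOn (T : Set (List A)) (X : Dual A) : Prop where
  nil : X [] = 1
  mul : ∀ u v : List A, u ++ v ∈ T → pairShuffle X u v = X u * X v

lemma IsCharOn.congr {T : Set (List A)} (hT : IsLowerWords T) (h0 : [] ∈ T) {X Y : Dual A}
    (hX : IsCharOn T X) (h : EqOn X Y T) : IsCharOn T Y where
  nil := by rw [← h h0, hX.nil]
  mul u v huv := by
    rw [← h (hT.left huv), ← h (hT.right huv), ← hX.mul u v huv]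
    exact pairShuffle_congr fun w hw => (h (mem_of_mem_shuffle hT huv hw)).symm

lemma isCharOn_counit (T : Set (List A)) : IsCharOn T (counit : Dual A) where
  nil := rfl
  mul u v _ := by
    match u, v with
    | [], v => simp [counit]
    | a :: u, [] => simp [counit]
    | a :: u, b :: v =>
      rw [pairShuffle_cons_cons]
      simp [counit, pairShuffle]

/-- Deconcatenation is multiplicative for the shuffle product, and the prefixes and suffixes of `u`
and `v` concatenate to words that are still in `T`. -/
lemma IsCharOn.conv {T : Set (List A)} (hT : IsLowerWords T) {X Y : Dual A} (hX : IsCharOn T X)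
    (hY : IsCharOn T Y) : IsCharOn T (conv X Y) where
  nil := by simp [hX.nil, hY.nil]
  mul u v huv := by
    rw [pairShuffle_conv, AnisoRP.conv, AnisoRP.conv, Finset.sum_mul_sum]
    refine Finset.sum_congr rfl fun i _ => Finset.sum_congr rfl fun j _ => ?_
    rw [hX.mul _ _ (hT.take_append_take huv i j), hY.mul _ _ (hT.drop_append_drop huv i j)]
    ring

lemma IsCharOn.convPow {T : Set (List A)} (hT : IsLowerWords T) {X : Dual A}
    (hX : IsCharOn T X) (n : ℕ) : IsCharOn T (convPow X n) := by
  induction n with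
  | zero => exact isCharOn_counit T
  | succ n ih => exact hX.conv hT ih

lemma isInfChar_iff {α : Dual A} : IsInfChar α ↔
    α [] = 0 ∧ ∀ a u b v, pairShuffle α (a :: u) (b :: v) = 0 := by
  constructor
  · intro h
    refine ⟨?_, fun a u b v => by simpa [counit] using h (a :: u) (b :: v)⟩
    have := h [] []
    simp [counit] at this
    linarith
  · rintro ⟨h0, h⟩ u v
    match u, v with
    | [], v => simp [counit, h0]
    | a :: u, [] => simp [counit, h0]
    | a :: u, b :: v => simp [counit, h]

lemma IsInfChar.nil {α : Dual A} (h : IsInfChar α) : α [] = 0 := (isInfChar_iff.1 h).1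

lemma IsInfChar.add {α β : Dual A} (hα : IsInfChar α) (hβ : IsInfChar β) :
    IsInfChar (α + β) := by
  rw [isInfChar_iff] at *
  refine ⟨by simp [hα.1, hβ.1], fun a u b v => ?_⟩
  rw [pairShuffle_add, hα.2, hβ.2, add_zero]

lemma IsInfChar.smul {α : Dual A} (hα : IsInfChar α) (c : ℝ) : IsInfChar (c • α) := by
  rw [isInfChar_iff] at *
  refine ⟨by simp [hα.1], fun a u b v => ?_⟩
  rw [pairShuffle_smul, hα.2, mul_zero]

lemma IsInfChar.sub {α β : Dual A} (hα : IsInfChar α) (hβ : IsInfChar β) :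
    IsInfChar (α - β) := by
  have : α - β = α + (-1 : ℝ) • β := by ext v; simp [sub_eq_add_neg]
  rw [this]; exact hα.add (hβ.smul _)

lemma isInfChar_zero : IsInfChar (0 : Dual A) := by
  rw [isInfChar_iff]; simp [pairShuffle_zero]

/-- Restricting an infinitesimal character to a set of words which does not depend on the order of
the letters, and extending it by zero. -/
lemma isInfChar_indicator {S : Set (List A)} (hS : ∀ ⦃u v : List A⦄, u.Perm v → (u ∈ S ↔ v ∈ S))
    {α : Dual A} (h0 : [] ∈ S → α [] = 0)
    (h : ∀ a u b v, (a :: u) ++ (b :: v) ∈ S → pairShuffle α (a :: u) (b :: v) = 0) :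
    IsInfChar (S.indicator α) := by
  classical
  rw [isInfChar_iff]
  refine ⟨by simpa [indicator_apply] using h0, fun a u b v => ?_⟩
  by_cases hm : (a :: u) ++ (b :: v) ∈ S
  · rw [← h a u b v hm]
    exact pairShuffle_congr fun w hw =>
      indicator_of_mem ((hS (perm_of_mem_shuffle hw)).2 hm) _
  · rw [pairShuffle_congr (g := 0)
      fun w hw => indicator_of_notMem (fun hw' => hm ((hS (perm_of_mem_shuffle hw)).1 hw')) _]
    exact pairShuffle_zero _ _

/-! ### The exponential -/

/-- The terms `α^{⋆ k} / k!` as the coefficients of a polynomial. -/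
noncomputable def expPoly (α : Dual A) (v : List A) : Polynomial ℝ :=
  ∑ k ∈ Finset.range (v.length + 1),
    Polynomial.monomial k (convPow α k v / (k.factorial : ℝ))

lemma expPoly_coeff {α : Dual A} (h0 : α [] = 0) (v : List A) (k : ℕ) :
    (expPoly α v).coeff k = convPow α k v / (k.factorial : ℝ) := by
  simp only [expPoly, Polynomial.finsetSum_coeff, Polynomial.coeff_monomial]
  rw [Finset.sum_ite_eq' (Finset.range (v.length + 1)) k]
  split_ifs with h
  · rfl
  · rw [convPow_eq_zero h0 (by simpa [Nat.lt_succ_iff] using h), zero_div]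

lemma expPoly_eval_one (α : Dual A) (v : List A) : (expPoly α v).eval 1 = expS α v := by
  simp [expPoly, expS, Polynomial.eval_finsetSum]

/-- `α` kills shuffles of two non-empty prefixes, so the double sum of `pairShuffle_conv` collapses
to its two edges. -/
lemma pairShuffle_conv_infChar {α : Dual A} (hα : IsInfChar α) (g : Dual A) (u v : List A) :
    pairShuffle (conv α g) u v =
      (∑ i ∈ Finset.range (u.length + 1), α (u.take i) * pairShuffle g (u.drop i) v) +
      ∑ j ∈ Finset.range (v.length + 1), α (v.take j) * pairShuffle g u (v.drop j) := by
  have hc : ∀ (w : List A) (i : ℕ), i ∈ Finset.range (w.length + 1) → i ≠ 0 →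
      counit (w.take i) = 0 := by
    intro w i hi h0
    cases w with
    | nil => simp at hi; omega
    | cons a w =>
      obtain ⟨i, rfl⟩ := Nat.exists_eq_succ_of_ne_zero h0
      simp [counit]
  rw [pairShuffle_conv]
  simp only [hα _ _, add_mul, Finset.sum_add_distrib]
  congr 1
  · refine Finset.sum_congr rfl fun i _ => ?_
    rw [Finset.sum_eq_single 0]
    · simp [counit]
    · intro j hj h0; simp [hc v j hj h0]
    · simp
  · rw [Finset.sum_eq_single 0]
    · simp [counit]
    · intro j hj h0; simp [hc u j hj h0]
    · simp

/-- The equation `d/dt exp(tα) = α ⋆ exp(tα)`, read off at the coefficient of `t^k`. -/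
lemma convPow_div_factorial_succ (α : Dual A) (k : ℕ) (v : List A) :
    ((k : ℝ) + 1) * (convPow α (k + 1) v / ((k + 1).factorial : ℝ)) =
      ∑ i ∈ Finset.range (v.length + 1),
        α (v.take i) * (convPow α k (v.drop i) / (k.factorial : ℝ)) := by
  have h1 : ((k : ℝ) + 1) ≠ 0 := by positivity
  have h2 : (k.factorial : ℝ) ≠ 0 := by positivity
  simp only [convPow, conv, Nat.factorial_succ, Nat.cast_mul, Nat.cast_succ]
  rw [← mul_div_assoc, mul_div_mul_left _ _ h1, Finset.sum_div]
  exact Finset.sum_congr rfl fun i _ => mul_div_assoc _ _ _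

/-- The Leibniz rule for the divided powers of an infinitesimal character. -/
lemma pairShuffle_convPow {α : Dual A} (hα : IsInfChar α) (k : ℕ) (u v : List A) :
    pairShuffle (convPow α k) u v / (k.factorial : ℝ) =
      ∑ p ∈ Finset.HasAntidiagonal.antidiagonal k, (convPow α p.1 u / (p.1.factorial : ℝ)) *
        (convPow α p.2 v / (p.2.factorial : ℝ)) := by
  induction k generalizing u v with
  | zero =>
    simp only [convPow, Finset.HasAntidiagonal.antidiagonal_zero, Finset.sum_singleton]
    simpa using (isCharOn_counit univ).mul u v trivial
  | succ k ih =>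
    have h1 : ((k : ℝ) + 1) ≠ 0 := by positivity
    have h2 : (k.factorial : ℝ) ≠ 0 := by positivity
    apply mul_left_cancel₀ h1
    have lhs : ((k : ℝ) + 1) * (pairShuffle (convPow α (k + 1)) u v / ((k + 1).factorial : ℝ)) =
        pairShuffle (conv α (convPow α k)) u v / (k.factorial : ℝ) := by
      rw [convPow, Nat.factorial_succ, Nat.cast_mul, Nat.cast_succ, ← mul_div_assoc,
        mul_div_mul_left _ _ h1]
    rw [lhs, pairShuffle_conv_infChar hα, add_div, Finset.sum_div, Finset.sum_div]
    simp only [mul_div_assoc, ih, Finset.mul_sum]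
    rw [Finset.sum_comm, Finset.sum_comm (s := Finset.range (v.length + 1))]
    have e1 : ∀ p : ℕ × ℕ, ∑ i ∈ Finset.range (u.length + 1), α (u.take i) *
        ((convPow α p.1 (u.drop i) / (p.1.factorial : ℝ)) *
          (convPow α p.2 v / (p.2.factorial : ℝ))) =
        ((p.1 : ℝ) + 1) * (convPow α (p.1 + 1) u / ((p.1 + 1).factorial : ℝ)) *
          (convPow α p.2 v / (p.2.factorial : ℝ)) := by
      intro p
      rw [convPow_div_factorial_succ, Finset.sum_mul]
      exact Finset.sum_congr rfl fun i _ => by ring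
    have e2 : ∀ p : ℕ × ℕ, ∑ i ∈ Finset.range (v.length + 1), α (v.take i) *
        ((convPow α p.1 u / (p.1.factorial : ℝ)) *
          (convPow α p.2 (v.drop i) / (p.2.factorial : ℝ))) =
        (convPow α p.1 u / (p.1.factorial : ℝ)) *
          (((p.2 : ℝ) + 1) * (convPow α (p.2 + 1) v / ((p.2 + 1).factorial : ℝ))) := by
      intro p
      rw [convPow_div_factorial_succ, Finset.mul_sum]
      exact Finset.sum_congr rfl fun i _ => by ring
    simp only [e1, e2]
    -- Both sums are shifted to the antidiagonal of `k + 1`; the added boundary terms carry a factor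
    -- 0. They then combine through `p.1 + p.2 = k + 1`.
    have s1 := Finset.Nat.sum_antidiagonal_succ (n := k) (f := fun p : ℕ × ℕ =>
      (p.1 : ℝ) * (convPow α p.1 u / (p.1.factorial : ℝ)) *
          (convPow α p.2 v / (p.2.factorial : ℝ)))
    have s2 := Finset.Nat.sum_antidiagonal_succ' (n := k) (f := fun p : ℕ × ℕ =>
      (convPow α p.1 u / (p.1.factorial : ℝ)) *
          ((p.2 : ℝ) * (convPow α p.2 v / (p.2.factorial : ℝ))))
    simp only [Nat.cast_zero, zero_mul, mul_zero, zero_add, Nat.cast_succ] at s1 s2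
    rw [← s1, ← s2, ← Finset.sum_add_distrib]
    refine Finset.sum_congr rfl fun p hp => ?_
    have : (p.1 : ℝ) + p.2 = k + 1 := by
      rw [Finset.HasAntidiagonal.mem_antidiagonal] at hp; exact_mod_cast hp
    rw [← this]; ring

/-- With `exp(tα)` as a polynomial in `t`, multiplicativity is the Leibniz rule compared coefficient
by coefficient, and the different cut-offs for `u`, `v` and their shuffles play no role. Then `t =
1`. -/
lemma IsInfChar.isCharOn_expS {α : Dual A} (hα : IsInfChar α) (T : Set (List A)) :
    IsCharOn T (expS α) where
  nil := expS_nil α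
  mul u v _ := by
    have key : ((shuffle u v).map (expPoly α)).sum = expPoly α u * expPoly α v := by
      ext k
      rw [Polynomial.coeff_mul]
      simp only [expPoly_coeff hα.nil]
      rw [← pairShuffle_convPow hα k u v]
      have : ∀ l : List (List A), ((l.map (expPoly α)).sum).coeff k =
          (l.map (convPow α k)).sum / (k.factorial : ℝ) := by
        intro l
        induction l with
        | nil => simp
        | cons w l ih => simp [ih, expPoly_coeff hα.nil, add_div]
      exact this _
    have := congrArg (Polynomial.eval 1) key
    rw [Polynomial.eval_mul, expPoly_eval_one, expPoly_eval_one] at this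
    rw [← this, pairShuffle]
    generalize shuffle u v = l
    induction l with
    | nil => simp
    | cons w l ih => simp [ih, expPoly_eval_one]

/-! ### Real powers and the logarithm -/

/-- The binomial series `∑ binom(t, k) (X - ε)^{⋆ k}` as a polynomial in `t`. -/
noncomputable def powPoly (X : Dual A) (v : List A) : Polynomial ℝ :=
  ∑ k ∈ Finset.range (v.length + 1),
    Polynomial.C (convPow (X - counit) k v / (k.factorial : ℝ)) * descPochhammer ℝ k

lemma polynomial_ext_nat {p q : Polynomial ℝ} (h : ∀ n : ℕ, p.eval (n : ℝ) = q.eval (n : ℝ)) :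
    p = q :=
  Polynomial.eq_of_infinite_eval_eq p q
    (Set.infinite_of_injective_forall_mem Nat.cast_injective h)

/-- The binomial theorem for `X = ε + (X - ε)`. The cut-off `N` is independent of the word so that
the induction hypothesis applies to all suffixes with the same `N`. -/
lemma convPow_eq_sum_choose {X : Dual A} (h1 : X [] = 1) (n N : ℕ) (v : List A)
    (hN : v.length < N) :
    convPow X n v = ∑ k ∈ Finset.range N, (n.choose k : ℝ) * convPow (X - counit) k v := by
  have hV : (X - counit : Dual A) [] = 0 := by simp [h1, counit]
  induction n generalizing v with
  | zero =>
    rw [Finset.sum_eq_single 0]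
    · simp [convPow]
    · intro k _ hk; rw [Nat.choose_eq_zero_of_lt (Nat.pos_of_ne_zero hk)]; simp
    · intro h; simp at h; omega
  | succ n ih =>
    have hX : X = counit + (X - counit) := by abel
    have e : convPow X (n + 1) v = convPow X n v + conv (X - counit) (convPow X n) v := by
      conv_lhs => rw [convPow]
      conv_lhs => enter [1]; rw [hX]
      rw [conv_add_left, counit_conv]; rfl
    have e2 : conv (X - counit) (convPow X n) v =
        ∑ k ∈ Finset.range N, (n.choose k : ℝ) * convPow (X - counit) (k + 1) v := by
      simp only [conv, convPow]
      simp only [Finset.mul_sum]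
      rw [Finset.sum_comm]
      refine Finset.sum_congr rfl fun i _ => ?_
      rw [ih _ (lt_of_le_of_lt (by simp) hN), Finset.mul_sum]
      exact Finset.sum_congr rfl fun k _ => by ring
    obtain ⟨M, rfl⟩ : ∃ M, N = M + 1 := ⟨N - 1, by omega⟩
    rw [e, e2, ih v hN, Finset.sum_range_succ' (fun k => _ * convPow _ k v) M,
      Finset.sum_range_succ' (fun k => _ * convPow _ k v) M,
      Finset.sum_range_succ (fun k => _ * convPow _ (k + 1) v) M, convPow_eq_zero hV hN]
    simp only [Nat.choose_succ_succ', Nat.cast_add, add_mul, Finset.sum_add_distrib,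
      Nat.choose_zero_right]
    ring

lemma powPoly_eval_nat {X : Dual A} (h1 : X [] = 1) (n : ℕ) (v : List A) :
    (powPoly X v).eval (n : ℝ) = convPow X n v := by
  rw [convPow_eq_sum_choose h1 n _ v (Nat.lt_succ_self _), powPoly, Polynomial.eval_finsetSum]
  refine Finset.sum_congr rfl fun k _ => ?_
  have h2 : (k.factorial : ℝ) ≠ 0 := by positivity
  rw [Polynomial.eval_mul, Polynomial.eval_C, descPochhammer_eval_eq_descFactorial,
    Nat.descFactorial_eq_factorial_mul_choose]
  push_cast
  field_simp

/-- The real powers `X^{⋆ t}`. -/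
noncomputable def convRpow (X : Dual A) (t : ℝ) : Dual A := fun v => (powPoly X v).eval t

lemma convRpow_natCast {X : Dual A} (h1 : X [] = 1) (n : ℕ) : convRpow X n = convPow X n :=
  funext fun v => powPoly_eval_nat h1 n v

/-- The law `X^{s+t} = X^s ⋆ X^t` as a polynomial identity in `s`. It is known for natural `s` and
`t`, and is freed one exponent at a time: first `s`, then `t` with `s` natural, and finally `s` with
`t` real. -/
lemma powPoly_comp {X : Dual A} (h1 : X [] = 1) (t : ℝ) (v : List A) :
    (powPoly X v).comp (Polynomial.X + Polynomial.C t) =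
      ∑ i ∈ Finset.range (v.length + 1),
        powPoly X (v.take i) * Polynomial.C ((powPoly X (v.drop i)).eval t) := by
  have nat : ∀ m : ℕ, (powPoly X v).comp (Polynomial.X + Polynomial.C (m : ℝ)) =
      ∑ i ∈ Finset.range (v.length + 1),
        powPoly X (v.take i) * Polynomial.C ((powPoly X (v.drop i)).eval (m : ℝ)) := by
    intro m
    apply polynomial_ext_nat
    intro n
    have := powPoly_eval_nat h1 (n + m) v
    rw [convPow_add] at this
    simp only [Polynomial.eval_comp, Polynomial.eval_add, Polynomial.eval_X, Polynomial.eval_C,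
      Polynomial.eval_finsetSum, Polynomial.eval_mul, powPoly_eval_nat h1]
    rw [Nat.cast_add] at this
    rw [this, conv]
  have nat' : ∀ n : ℕ, (powPoly X v).comp (Polynomial.C (n : ℝ) + Polynomial.X) =
      ∑ i ∈ Finset.range (v.length + 1),
        Polynomial.C ((powPoly X (v.take i)).eval (n : ℝ)) * powPoly X (v.drop i) := by
    intro n
    apply polynomial_ext_nat
    intro m
    have := congrArg (Polynomial.eval (n : ℝ)) (nat m)
    simpa [Polynomial.eval_comp, Polynomial.eval_finsetSum] using this
  apply polynomial_ext_nat
  intro n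
  have := congrArg (Polynomial.eval t) (nat' n)
  simpa [Polynomial.eval_comp, Polynomial.eval_finsetSum] using this

lemma convRpow_add {X : Dual A} (h1 : X [] = 1) (s t : ℝ) :
    convRpow X (s + t) = conv (convRpow X s) (convRpow X t) := by
  ext v
  have := congrArg (Polynomial.eval s) (powPoly_comp h1 t v)
  simpa [Polynomial.eval_comp, Polynomial.eval_finsetSum, convRpow, conv] using this

lemma conv_convRpow_neg_one {X : Dual A} (h1 : X [] = 1) :
    conv X (convRpow X (-1)) = counit := by
  have e0 := convRpow_natCast h1 0
  have e1 := convRpow_natCast h1 1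
  have e := convRpow_add h1 1 (-1)
  rw [convPow_one, Nat.cast_one] at e1
  rw [Nat.cast_zero] at e0
  rw [add_neg_cancel, e0, e1] at e
  exact e.symm

/-- Factoring out the root 0 leaves the falling factorial of length `k` at `-1`. After division by
`(k + 1)!` this is the coefficient `(-1)^k / (k + 1)` of the logarithm. -/
lemma derivative_descPochhammer_eval_zero (k : ℕ) :
    (Polynomial.derivative (descPochhammer ℝ (k + 1))).eval 0 = (-1) ^ k * (k.factorial : ℝ) := by
  have h : ∀ k : ℕ, (descPochhammer ℝ k).eval (-1) = (-1) ^ k * (k.factorial : ℝ) := by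
    intro k
    induction k with
    | zero => simp
    | succ k ih =>
      rw [descPochhammer_succ_right, Polynomial.eval_mul, ih, Nat.factorial_succ]
      simp
      ring
  rw [descPochhammer_succ_left]
  simp [Polynomial.derivative_comp, Polynomial.eval_comp, h]

lemma powPoly_derivative_eval_zero (X : Dual A) (v : List A) :
    (Polynomial.derivative (powPoly X v)).eval 0 = logS X v := by
  rw [powPoly, logS, Polynomial.derivative_sum, Polynomial.eval_finsetSum,
    Finset.sum_range_succ']
  rw [← Finset.Ico_add_one_right_eq_Icc, Finset.sum_Ico_eq_sum_range]
  simp only [Polynomial.derivative_mul, Polynomial.derivative_C, zero_mul, zero_add,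
    Polynomial.eval_mul, Polynomial.eval_C, descPochhammer_zero, Polynomial.derivative_one,
    Polynomial.eval_zero, mul_zero, add_zero, derivative_descPochhammer_eval_zero]
  refine Finset.sum_congr (by simp) fun k _ => ?_
  have h1 : ((k : ℝ) + 1) ≠ 0 := by positivity
  have h2 : (k.factorial : ℝ) ≠ 0 := by positivity
  rw [Nat.factorial_succ, add_comm 1 k]
  push_cast
  field_simp
  ring

/-- Differentiating `X^{s+t} = X^s ⋆ X^t` in `s` at 0. -/
lemma powPoly_derivative {X : Dual A} (h1 : X [] = 1) (v : List A) :
    Polynomial.derivative (powPoly X v) =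
      ∑ i ∈ Finset.range (v.length + 1),
        Polynomial.C (logS X (v.take i)) * powPoly X (v.drop i) := by
  apply Polynomial.funext
  intro t
  have := congrArg (fun p => (Polynomial.derivative p).eval 0) (powPoly_comp h1 t v)
  simpa [Polynomial.derivative_comp, Polynomial.eval_comp, Polynomial.eval_finsetSum,
    Polynomial.derivative_sum, powPoly_derivative_eval_zero] using this

/-- The differential equation `powPoly_derivative` has the recursion of the exponential series, so
`X^t = exp(t log X)`. -/
lemma powPoly_coeff {X : Dual A} (h1 : X [] = 1) (k : ℕ) (v : List A) :
    (powPoly X v).coeff k = convPow (logS X) k v / (k.factorial : ℝ) := by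
  induction k generalizing v with
  | zero =>
    rw [Polynomial.coeff_zero_eq_eval_zero]
    simpa [convPow] using powPoly_eval_nat h1 0 v
  | succ k ih =>
    have h3 : ((k : ℝ) + 1) ≠ 0 := by positivity
    apply mul_left_cancel₀ h3
    rw [convPow_div_factorial_succ]
    have := congrArg (fun p => p.coeff k) (powPoly_derivative h1 v)
    simp only [Polynomial.coeff_derivative, Polynomial.finsetSum_coeff,
      Polynomial.coeff_C_mul, ih] at this
    rw [mul_comm, this]

lemma expS_logS {X : Dual A} (h1 : X [] = 1) : expS (logS X) = X := by
  ext v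
  have hd : (powPoly X v).natDegree < v.length + 1 := by
    refine Nat.lt_succ_of_le (Polynomial.natDegree_sum_le_of_forall_le _ _ fun k hk => ?_)
    refine (Polynomial.natDegree_C_mul_le _ _).trans ?_
    rw [descPochhammer_natDegree]
    exact Nat.le_of_lt_succ (Finset.mem_range.1 hk)
  have e := powPoly_eval_nat h1 1 v
  rw [convPow_one, Polynomial.eval_eq_sum_range' hd] at e
  rw [← e]
  simp [expS, powPoly_coeff h1]

lemma IsCharOn.powPoly {T : Set (List A)} (hT : IsLowerWords T) {X : Dual A}
    (hX : IsCharOn T X) {u v : List A} (huv : u ++ v ∈ T) :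
    ((shuffle u v).map (powPoly X)).sum = powPoly X u * powPoly X v := by
  apply polynomial_ext_nat
  intro n
  have := (hX.convPow hT n).mul u v huv
  rw [Polynomial.eval_mul, powPoly_eval_nat hX.nil, powPoly_eval_nat hX.nil, ← this, pairShuffle]
  generalize shuffle u v = l
  induction l with
  | nil => simp
  | cons w l ih => simp [ih, powPoly_eval_nat hX.nil]

lemma IsCharOn.convRpow {T : Set (List A)} (hT : IsLowerWords T) {X : Dual A}
    (hX : IsCharOn T X) (t : ℝ) : IsCharOn T (convRpow X t) where
  nil := by simp [AnisoRP.convRpow, AnisoRP.powPoly, AnisoRP.convPow, counit]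
  mul u v huv := by
    have := congrArg (Polynomial.eval t) (hX.powPoly hT huv)
    rw [Polynomial.eval_mul] at this
    rw [AnisoRP.convRpow, AnisoRP.convRpow, ← this, pairShuffle]
    generalize shuffle u v = l
    induction l with
    | nil => simp
    | cons w l ih => rw [List.map_cons, List.sum_cons, ih]; simp [AnisoRP.convRpow]

/-- Differentiate `X^t(u ⧢ v) = X^t(u) X^t(v)` at `t = 0`: since `X^0 = ε` vanishes on non-empty
words, both terms of the product rule are zero. -/
lemma IsCharOn.pairShuffle_logS {T : Set (List A)} (hT : IsLowerWords T) {X : Dual A}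
    (hX : IsCharOn T X) (a : A) (u : List A) (b : A) (v : List A)
    (huv : (a :: u) ++ (b :: v) ∈ T) : pairShuffle (logS X) (a :: u) (b :: v) = 0 := by
  have := congrArg (fun p => (Polynomial.derivative p).eval 0) (hX.powPoly hT huv)
  have h0 : ∀ a (u : List A), (AnisoRP.powPoly X (a :: u)).eval 0 = 0 := fun a u => by
    simpa [AnisoRP.convPow, counit] using powPoly_eval_nat hX.nil 0 (a :: u)
  simp only [Polynomial.derivative_mul, Polynomial.eval_add, Polynomial.eval_mul, h0, mul_zero,
    zero_mul, add_zero] at this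
  rw [← this, pairShuffle]
  generalize shuffle (a :: u) (b :: v) = l
  induction l with
  | nil => simp
  | cons w l ih => simp [ih, powPoly_derivative_eval_zero]

/-- The truncated logarithm of a truncated character is an infinitesimal character. -/
lemma IsCharOn.isInfChar_indicator_logS {T : Set (List A)} (hT : IsLowerWords T) {X : Dual A}
    (hX : IsCharOn T X) {S : Set (List A)} (hS : ∀ ⦃u v : List A⦄, u.Perm v → (u ∈ S ↔ v ∈ S))
    (hST : S ⊆ T) : IsInfChar (S.indicator (logS X)) :=
  isInfChar_indicator hS (fun _ => logS_nil X)
    fun a u b v h => hX.pairShuffle_logS hT a u b v (hST h)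

/-! ### The antipode -/

/-- A shuffle in the `i`-th term starts with the `i`-th or the `(i+1)`-st letter of `q`, and
neighbouring terms cancel. Only shuffles starting with the first letter of `p` survive; the
accumulator `p` is what lets the induction on `q` run. -/
lemma sum_antipode (f : Dual A) (p q : List A) :
    ∑ i ∈ Finset.range (q.length + 1),
      (-1 : ℝ) ^ i * pairShuffle f ((q.take i).reverse ++ p) (q.drop i) =
    match p, q with
    | a :: p, q => pairShuffle (fun w => f (a :: w)) p q
    | [], [] => f []
    | [], _ :: _ => 0 := by
  induction q generalizing p with
  | nil => cases p <;> simp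
  | cons b q ih =>
    rw [List.length_cons, Finset.sum_range_succ']
    simp only [List.take_succ_cons, List.reverse_cons, List.append_assoc, List.drop_succ_cons,
      pow_succ, mul_neg, mul_one, neg_mul, Finset.sum_neg_distrib, List.cons_append,
      List.nil_append]
    rw [ih (b :: p)]
    cases p with
    | nil => simp
    | cons a p => simp [pairShuffle_cons_cons]

lemma IsCharOn.inv_conv {T : Set (List A)} (hT : IsLowerWords T) {X : Dual A}
    (hX : IsCharOn T X) : EqOn (AnisoRP.conv (inv X) X) counit T := by
  intro v hv
  have := sum_antipode X [] v
  rw [AnisoRP.conv]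
  trans ∑ i ∈ Finset.range (v.length + 1),
      (-1 : ℝ) ^ i * pairShuffle X ((v.take i).reverse ++ []) (v.drop i)
  · refine Finset.sum_congr rfl fun i hi => ?_
    have hi' : i ≤ v.length := Nat.le_of_lt_succ (Finset.mem_range.1 hi)
    rw [List.append_nil, hX.mul, inv, List.length_take, min_eq_left hi', mul_assoc]
    have : ((v.take i).reverse ++ v.drop i).Perm v := by
      conv_rhs => rw [← List.take_append_drop i v]
      exact (List.reverse_perm _).append_right _
    exact hT hv this.subperm
  · rw [this]
    cases v <;> simp [counit, hX.nil]

/-- A left inverse agrees with a right inverse. This identifies `X ∘ S` with a real power of `X`,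
from which it inherits being a character and a two-sided inverse on `T`. -/
lemma IsCharOn.inv_eqOn {T : Set (List A)} (hT : IsLowerWords T) {X : Dual A}
    (hX : IsCharOn T X) : EqOn (inv X) (AnisoRP.convRpow X (-1)) T := by
  have h := conv_convRpow_neg_one hX.nil
  have := conv_congr hT (hX.inv_conv hT) (eqOn_refl (AnisoRP.convRpow X (-1)) T)
  rw [conv_assoc, h, counit_conv, conv_counit] at this
  exact this

lemma IsCharOn.inv {T : Set (List A)} (hT : IsLowerWords T) (h0 : [] ∈ T) {X : Dual A}
    (hX : IsCharOn T X) : IsCharOn T (inv X) :=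
  (hX.convRpow hT (-1)).congr hT h0 (hX.inv_eqOn hT).symm

lemma IsCharOn.conv_inv {T : Set (List A)} (hT : IsLowerWords T) {X : Dual A}
    (hX : IsCharOn T X) : EqOn (AnisoRP.conv X (AnisoRP.inv X)) counit T := by
  have h := conv_convRpow_neg_one hX.nil
  have := conv_congr hT (eqOn_refl X T) (hX.inv_eqOn hT)
  rwa [h] at this

/-! ### Homogeneous bounds -/

section Bounds
variable {ι : Type*}

/-- A family of numbers which is bounded by a multiple of the power `w` of a scale. -/
def PowBound (S : Set ι) (h : ι → ℝ) (w : ℝ) (f : ι → ℝ) : Prop :=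
  ∃ C : ℝ, 0 ≤ C ∧ ∀ i ∈ S, |f i| ≤ C * h i ^ w

variable {S : Set ι} {h : ι → ℝ} {w : ℝ}

lemma PowBound.congr {f g : ι → ℝ} (hf : PowBound S h w f) (hfg : ∀ i ∈ S, f i = g i) :
    PowBound S h w g := by
  obtain ⟨C, hC, H⟩ := hf
  exact ⟨C, hC, fun i hi => hfg i hi ▸ H i hi⟩

lemma powBound_zero : PowBound S h w (fun _ => 0) :=
  ⟨0, le_rfl, fun i _ => by simp⟩

lemma PowBound.add {f g : ι → ℝ} (hf : PowBound S h w f) (hg : PowBound S h w g) :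
    PowBound S h w (fun i => f i + g i) := by
  obtain ⟨C, hC, H⟩ := hf
  obtain ⟨D, hD, G⟩ := hg
  refine ⟨C + D, add_nonneg hC hD, fun i hi => (abs_add_le _ _).trans ?_⟩
  rw [add_mul]
  exact add_le_add (H i hi) (G i hi)

lemma PowBound.const_mul {f : ι → ℝ} (hf : PowBound S h w f) (c : ℝ) :
    PowBound S h w (fun i => c * f i) := by
  obtain ⟨C, hC, H⟩ := hf
  refine ⟨|c| * C, by positivity, fun i hi => ?_⟩
  rw [abs_mul, mul_assoc]
  exact mul_le_mul_of_nonneg_left (H i hi) (abs_nonneg c)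

lemma PowBound.sum {κ : Type*} (s : Finset κ) {f : κ → ι → ℝ}
    (hf : ∀ k ∈ s, PowBound S h w (f k)) : PowBound S h w (fun i => ∑ k ∈ s, f k i) := by
  classical
  induction s using Finset.induction_on with
  | empty => simpa using powBound_zero
  | insert k s hk ih =>
    simp only [Finset.sum_insert hk]
    exact (hf k (Finset.mem_insert_self k s)).add
      (ih fun j hj => hf j (Finset.mem_insert_of_mem hj))

lemma PowBound.mul (hh : ∀ i ∈ S, 0 ≤ h i) {w' : ℝ} (hw : 0 ≤ w) (hw' : 0 ≤ w') {f g : ι → ℝ}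
    (hf : PowBound S h w f) (hg : PowBound S h w' g) :
    PowBound S h (w + w') (fun i => f i * g i) := by
  obtain ⟨C, hC, H⟩ := hf
  obtain ⟨D, hD, G⟩ := hg
  refine ⟨C * D, by positivity, fun i hi => ?_⟩
  rw [abs_mul, Real.rpow_add_of_nonneg (hh i hi) hw hw', mul_mul_mul_comm]
  have := Real.rpow_nonneg (hh i hi) w
  exact mul_le_mul (H i hi) (G i hi) (abs_nonneg _) (by positivity)

end Bounds

/-! ### Functionals scaling with the exponents of the letters -/

section Homogeneous
variable {ι : Type*}

/-- The sum of the exponents of the letters of a word. -/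
def expSum (γ : A → ℝ) (v : List A) : ℝ := (v.map γ).sum

@[simp] lemma expSum_nil (γ : A → ℝ) : expSum γ [] = 0 := by simp [expSum]

lemma expSum_singleton (γ : A → ℝ) (a : A) : expSum γ [a] = γ a := by simp [expSum]

lemma expSum_append (γ : A → ℝ) (u v : List A) :
    expSum γ (u ++ v) = expSum γ u + expSum γ v := by simp [expSum]

lemma expSum_take_add_drop (γ : A → ℝ) (v : List A) (i : ℕ) :
    expSum γ (v.take i) + expSum γ (v.drop i) = expSum γ v := by
  rw [← expSum_append, List.take_append_drop]

lemma expSum_perm (γ : A → ℝ) {u v : List A} (h : u.Perm v) : expSum γ u = expSum γ v :=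
  (h.map γ).sum_eq

lemma expSum_nonneg {γ : A → ℝ} (hγ : ∀ a, 0 < γ a) (v : List A) : 0 ≤ expSum γ v :=
  List.sum_nonneg fun x hx => by
    obtain ⟨a, _, rfl⟩ := List.mem_map.1 hx
    exact (hγ a).le

lemma expSum_pos {γ : A → ℝ} (hγ : ∀ a, 0 < γ a) {v : List A} (hv : v ≠ []) :
    0 < expSum γ v := by
  obtain ⟨a, v, rfl⟩ := List.exists_cons_of_ne_nil hv
  have := expSum_nonneg hγ v
  simp only [expSum, List.map_cons, List.sum_cons] at *
  linarith [hγ a]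

lemma expSum_le_of_subperm {γ : A → ℝ} (hγ : ∀ a, 0 < γ a) {u v : List A} (h : u.Subperm v) :
    expSum γ u ≤ expSum γ v := by
  obtain ⟨l, hl, hs⟩ := h
  rw [← expSum_perm γ hl]
  exact (hs.map γ).sum_le_sum fun x hx => by
    obtain ⟨a, _, rfl⟩ := List.mem_map.1 hx
    exact (hγ a).le

/-- Families of functionals with the homogeneity of rough paths on a set of words. -/
def HomBound (γ : A → ℝ) (S : Set ι) (h : ι → ℝ) (T : Set (List A)) (f : ι → Dual A) : Prop :=
  ∀ v ∈ T, PowBound S h (expSum γ v) (fun i => f i v)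

variable {γ : A → ℝ} {S : Set ι} {h : ι → ℝ} {T : Set (List A)}

lemma HomBound.congr {f g : ι → Dual A} (hf : HomBound γ S h T f)
    (hfg : ∀ i ∈ S, EqOn (f i) (g i) T) : HomBound γ S h T g :=
  fun v hv => (hf v hv).congr fun i hi => hfg i hi hv

lemma homBound_counit :
    HomBound γ S h T (fun _ => counit) := by
  intro v _
  cases v with
  -- The exponent is 0 here, and `0 ^ 0 = 1` keeps the bound valid at scale 0.
  | nil => exact ⟨1, zero_le_one, fun i _ => by simp [counit]⟩
  | cons a v => exact powBound_zero

lemma HomBound.add {f g : ι → Dual A} (hf : HomBound γ S h T f) (hg : HomBound γ S h T g) :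
    HomBound γ S h T (fun i => f i + g i) := fun v hv => (hf v hv).add (hg v hv)

lemma HomBound.smul {f : ι → Dual A} (hf : HomBound γ S h T f) (c : ℝ) :
    HomBound γ S h T (fun i => c • f i) := fun v hv => (hf v hv).const_mul c

lemma HomBound.indicator {f : ι → Dual A} {T' : Set (List A)}
    (hf : HomBound γ S h T f) (hT : ∀ v ∈ T', v ∈ T) :
    HomBound γ S h univ (fun i => T'.indicator (f i)) := by
  intro v _
  by_cases hv : v ∈ T'
  · exact (hf v (hT v hv)).congr fun i _ => (indicator_of_mem hv _).symm
  · exact (powBound_zero).congr fun i _ => (indicator_of_notMem hv _).symm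

lemma HomBound.mono {f : ι → Dual A} {T' : Set (List A)} (hf : HomBound γ S h T f)
    (hT : T' ⊆ T) : HomBound γ S h T' f := fun v hv => hf v (hT hv)

/-- The exponents of a prefix and its suffix add up to those of the word, so products, and with them
`expS` and `logS`, keep the homogeneity. -/
lemma HomBound.conv (hγ : ∀ a, 0 < γ a) (hh : ∀ i ∈ S, 0 ≤ h i) (hT : IsLowerWords T)
    {f g : ι → Dual A} (hf : HomBound γ S h T f) (hg : HomBound γ S h T g) :
    HomBound γ S h T (fun i => conv (f i) (g i)) := by
  intro v hv
  refine PowBound.sum _ fun j _ => ?_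
  rw [← expSum_take_add_drop γ v j]
  exact (hf _ (hT.take hv j)).mul hh (expSum_nonneg hγ _) (expSum_nonneg hγ _)
    (hg _ (hT.drop hv j))

lemma HomBound.convPow (hγ : ∀ a, 0 < γ a) (hh : ∀ i ∈ S, 0 ≤ h i) (hT : IsLowerWords T)
    {f : ι → Dual A} (hf : HomBound γ S h T f) (k : ℕ) :
    HomBound γ S h T (fun i => convPow (f i) k) := by
  induction k with
  | zero => exact homBound_counit
  | succ k ih => exact hf.conv hγ hh hT ih

lemma HomBound.expS (hγ : ∀ a, 0 < γ a) (hh : ∀ i ∈ S, 0 ≤ h i) (hT : IsLowerWords T)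
    {f : ι → Dual A} (hf : HomBound γ S h T f) : HomBound γ S h T (fun i => expS (f i)) := by
  intro v hv
  refine PowBound.sum _ fun k _ => ?_
  exact ((hf.convPow hγ hh hT k v hv).const_mul (k.factorial : ℝ)⁻¹).congr
    fun i _ => by rw [div_eq_inv_mul]

lemma HomBound.logS (hγ : ∀ a, 0 < γ a) (hh : ∀ i ∈ S, 0 ≤ h i) (hT : IsLowerWords T)
    {f : ι → Dual A} (hf : HomBound γ S h T f) : HomBound γ S h T (fun i => logS (f i)) := by
  intro v hv
  refine PowBound.sum _ fun k _ => ?_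
  have hf' : HomBound γ S h T (fun i => f i - counit) :=
    (hf.add ((homBound_counit).smul (-1))).congr fun i _ v _ => by
      simp [sub_eq_add_neg]
  exact ((hf'.convPow hγ hh hT k v hv).const_mul ((-1) ^ (k + 1) / k)).congr
    fun i _ => by ring

end Homogeneous

/-! ### Two estimates on dyadic partitions -/

/-- Relative to the scale `2^{-mw}`, one halving multiplies the old term by `q = 2^w / 2`, which is
below 1 exactly for `w < 1`; the constant solves `C = C q + B`. For `w = 1` this recursion would
only give an extra factor `m`. -/
lemma halving_bound {w B : ℝ} (hw : w < 1) (hB : 0 ≤ B) {z : ℕ → ℕ → ℝ}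
    (h0 : ∀ k, z 0 k = 0)
    (hs : ∀ m k, k < 2 ^ (m + 1) →
      |z (m + 1) k| ≤ 1 / 2 * |z m (k / 2)| + B * (((2 : ℝ) ^ (m + 1))⁻¹) ^ w) :
    ∃ C : ℝ, 0 ≤ C ∧ ∀ m k, k < 2 ^ m → |z m k| ≤ C * (((2 : ℝ) ^ m)⁻¹) ^ w := by
  set q : ℝ := 2 ^ w / 2 with hq
  have hq1 : q < 1 := by
    have : (2 : ℝ) ^ w < 2 ^ (1 : ℝ) := Real.rpow_lt_rpow_of_exponent_lt (by norm_num) hw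
    rw [Real.rpow_one] at this
    rw [hq]; linarith
  have hC : 0 ≤ B / (1 - q) := div_nonneg hB (by linarith)
  refine ⟨B / (1 - q), hC, fun m => ?_⟩
  induction m with
  | zero => intro k _; rw [h0]; simpa using hC
  | succ m ih =>
    intro k hk
    have h2 : (((2 : ℝ) ^ m)⁻¹) ^ w = 2 ^ w * (((2 : ℝ) ^ (m + 1))⁻¹) ^ w := by
      rw [← Real.mul_rpow (by norm_num) (by positivity)]
      congr 1
      rw [pow_succ]; field_simp
    have h3 := ih (k / 2) (by rw [pow_succ] at hk; omega)
    rw [h2] at h3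
    have h4 : B = B / (1 - q) * (1 - q) := by
      have : 1 - q ≠ 0 := by linarith
      field_simp
    calc |z (m + 1) k| ≤ _ := hs m k hk
      _ ≤ 1 / 2 * (B / (1 - q) * (2 ^ w * (((2 : ℝ) ^ (m + 1))⁻¹) ^ w)) +
          B * (((2 : ℝ) ^ (m + 1))⁻¹) ^ w := by gcongr
      _ = (B / (1 - q) * q + B) * (((2 : ℝ) ^ (m + 1))⁻¹) ^ w := by rw [hq]; ring
      _ = B / (1 - q) * (((2 : ℝ) ^ (m + 1))⁻¹) ^ w := by
        congr 1
        nth_rewrite 2 [h4]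
        ring

/-- An almost additive function of intervals with integer endpoints which is small on the dyadic
intervals is small on all intervals. -/
lemma chaining_bound {w : ℝ} (hw : 0 < w) :
    ∃ C : ℝ, 0 ≤ C ∧ ∀ (N : ℕ) (K : ℝ) (F : ℕ → ℕ → ℝ), 0 ≤ K →
      (∀ i j k, i ≤ j → j ≤ k → k ≤ N → |F i k - F i j - F j k| ≤ K * ((k - i : ℕ) : ℝ) ^ w) →
      (∀ p k, (k + 1) * 2 ^ p ≤ N →
        |F (k * 2 ^ p) ((k + 1) * 2 ^ p)| ≤ K * ((2 : ℝ) ^ p) ^ w) →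
      ∀ i j, i ≤ j → j ≤ N → |F i j| ≤ C * K * ((j - i : ℕ) : ℝ) ^ w := by
  set q : ℝ := ((2 : ℝ) ^ w)⁻¹ with hq
  have h2w : 1 < (2 : ℝ) ^ w := Real.one_lt_rpow (by norm_num) hw
  have hq1 : q < 1 := inv_lt_one_of_one_lt₀ h2w
  have hq0 : 0 < q := by positivity
  -- Constant for intervals with one end at an end of a surrounding dyadic block. Cutting at the
  -- midpoint costs at most 1 for the defect, 1 for the full half and `D q` for the other part,
  -- whence `D = 2 + D q`.
  set D : ℝ := 2 / (1 - q) with hD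
  have hDeq : 2 + D * q = D := by
    have : 1 - q ≠ 0 := by linarith
    rw [hD]; field_simp; ring
  have hD2 : 2 ≤ D := by
    have : 0 ≤ D := div_nonneg zero_le_two (by linarith)
    nlinarith
  refine ⟨5 * D, by linarith, fun N K F hK hδ hF => ?_⟩
  have hpow : ∀ p : ℕ, ((2 : ℝ) ^ p) ^ w = q * ((2 : ℝ) ^ (p + 1)) ^ w := by
    intro p
    rw [pow_succ, Real.mul_rpow (by positivity) (by norm_num), hq]
    have : (2 : ℝ) ^ w ≠ 0 := by positivity
    field_simp
  have hmono : ∀ (r p : ℕ), r ≤ 2 ^ p → (r : ℝ) ^ w ≤ ((2 : ℝ) ^ p) ^ w := fun r p hr =>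
    Real.rpow_le_rpow (by positivity) (by exact_mod_cast hr) hw.le
  have hzero : ∀ i, i ≤ N → F i i = 0 := by
    intro i hi
    have := hδ i i i le_rfl le_rfl hi
    simp [Real.zero_rpow hw.ne'] at this
    exact this
  have base : ∀ i j, i ≤ j → j ≤ N → j ≤ i + 1 → |F i j| ≤ D * K := by
    intro i j hij hjN hji
    rcases Nat.eq_or_lt_of_le hij with rfl | h
    · rw [hzero i hjN, abs_zero]; exact mul_nonneg (by linarith) hK
    · obtain rfl : j = i + 1 := by omega
      have := hF 0 i (by simpa using hjN)
      simp at this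
      exact this.trans (by nlinarith)
  have step : ∀ (p : ℕ) (i j k : ℕ), i ≤ j → j ≤ k → k ≤ N → k - i ≤ 2 ^ (p + 1) →
      (|F i j| ≤ K * ((2 : ℝ) ^ p) ^ w ∧ |F j k| ≤ D * K * ((2 : ℝ) ^ p) ^ w ∨
       |F i j| ≤ D * K * ((2 : ℝ) ^ p) ^ w ∧ |F j k| ≤ K * ((2 : ℝ) ^ p) ^ w) →
      |F i k| ≤ D * K * ((2 : ℝ) ^ (p + 1)) ^ w := by
    intro p i j k hij hjk hk hki h
    have h1 := (hδ i j k hij hjk hk).trans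
      (mul_le_mul_of_nonneg_left (hmono _ _ hki) hK)
    have h2 : |F i k| ≤ |F i k - F i j - F j k| + |F i j| + |F j k| := by
      have := abs_add_three (F i k - F i j - F j k) (F i j) (F j k)
      rwa [show F i k - F i j - F j k + F i j + F j k = F i k by ring] at this
    rw [hpow p] at h
    set P := ((2 : ℝ) ^ (p + 1)) ^ w
    have hP : 0 ≤ P := by positivity
    have h3 : K * (q * P) ≤ K * P := by
      apply mul_le_mul_of_nonneg_left _ hK
      nlinarith
    have h4 : D * K * P = 2 * (K * P) + D * K * (q * P) := by
      nth_rewrite 1 [← hDeq]; ring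
    rcases h with ⟨h5, h6⟩ | ⟨h5, h6⟩ <;> linarith
  have right : ∀ (p k j : ℕ), k * 2 ^ p ≤ j → j ≤ N → j ≤ (k + 1) * 2 ^ p →
      |F (k * 2 ^ p) j| ≤ D * K * ((2 : ℝ) ^ p) ^ w := by
    intro p
    induction p with
    | zero =>
      intro k j h1 h2 h3
      simpa using base k j (by simpa using h1) h2 (by simpa using h3)
    | succ p ih =>
      intro k j h1 h2 h3
      have e1 : k * 2 ^ (p + 1) = (2 * k) * 2 ^ p := by ring
      have e2 : (k + 1) * 2 ^ (p + 1) = (2 * k + 1 + 1) * 2 ^ p := by ring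
      have e3 : (2 * k + 1) * 2 ^ p = 2 * k * 2 ^ p + 2 ^ p := by ring
      have e4 : (2 * k + 1 + 1) * 2 ^ p = 2 * k * 2 ^ p + 2 ^ p + 2 ^ p := by ring
      rw [e1] at h1 ⊢
      rw [e2] at h3
      rcases le_total j ((2 * k + 1) * 2 ^ p) with h | h
      · refine (ih (2 * k) j h1 h2 h).trans ?_
        rw [hpow p]
        have : (0 : ℝ) ≤ ((2 : ℝ) ^ (p + 1)) ^ w := by positivity
        apply mul_le_mul_of_nonneg_left _ (mul_nonneg (by linarith) hK)
        nlinarith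
      · refine step p _ ((2 * k + 1) * 2 ^ p) j (by omega) h h2 ?_ (Or.inl
          ⟨hF p (2 * k) (h.trans h2), ih (2 * k + 1) j h h2 h3⟩)
        rw [pow_succ]; omega
  have left : ∀ (p k i : ℕ), i ≤ (k + 1) * 2 ^ p → (k + 1) * 2 ^ p ≤ N → k * 2 ^ p ≤ i →
      |F i ((k + 1) * 2 ^ p)| ≤ D * K * ((2 : ℝ) ^ p) ^ w := by
    intro p
    induction p with
    | zero =>
      intro k i h1 h2 h3
      simpa using base i (k + 1) (by simpa using h1) (by simpa using h2) (by simp at h3; omega)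
    | succ p ih =>
      intro k i h1 h2 h3
      have e1 : k * 2 ^ (p + 1) = (2 * k) * 2 ^ p := by ring
      have e2 : (k + 1) * 2 ^ (p + 1) = (2 * k + 1 + 1) * 2 ^ p := by ring
      have e3 : (2 * k + 1) * 2 ^ p = 2 * k * 2 ^ p + 2 ^ p := by ring
      have e4 : (2 * k + 1 + 1) * 2 ^ p = 2 * k * 2 ^ p + 2 ^ p + 2 ^ p := by ring
      rw [e1] at h3
      rw [e2] at h1 h2 ⊢
      rcases le_total ((2 * k + 1) * 2 ^ p) i with h | h
      · refine (ih (2 * k + 1) i h1 h2 h).trans ?_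
        rw [hpow p]
        have : (0 : ℝ) ≤ ((2 : ℝ) ^ (p + 1)) ^ w := by positivity
        apply mul_le_mul_of_nonneg_left _ (mul_nonneg (by linarith) hK)
        nlinarith
      · refine step p i ((2 * k + 1) * 2 ^ p) _ h (by omega) h2 ?_ (Or.inr
          ⟨ih (2 * k) i h (by omega) h3, hF p (2 * k + 1) h2⟩)
        rw [pow_succ]; omega
  intro i j hij hj
  rcases Nat.eq_or_lt_of_le hij with rfl | hlt
  · rw [hzero i hj, abs_zero]
    have : 0 ≤ D := by linarith
    positivity
  -- At this scale the end of the block containing `i` lies in `[i, j]`, and beyond it there is at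
  -- most one full block and a remainder. Three one-sided pieces and two defects give the factor 5.
  obtain ⟨p, hp1, hp2⟩ : ∃ p, 2 ^ p ≤ j - i ∧ j - i < 2 ^ (p + 1) :=
    ⟨Nat.log 2 (j - i), Nat.pow_log_le_self 2 (by omega), Nat.lt_pow_succ_log_self (by norm_num) _⟩
  have hpj : ((2 : ℝ) ^ p) ^ w ≤ ((j - i : ℕ) : ℝ) ^ w :=
    Real.rpow_le_rpow (by positivity) (by exact_mod_cast hp1) hw.le
  obtain ⟨k, hk1, hk2⟩ : ∃ k, k * 2 ^ p ≤ i ∧ i < (k + 1) * 2 ^ p := by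
    refine ⟨i / 2 ^ p, Nat.div_mul_le_self _ _, ?_⟩
    have := Nat.lt_mul_div_succ i (show 0 < 2 ^ p by positivity)
    rwa [mul_comm] at this
  have e3 : (k + 1) * 2 ^ p = k * 2 ^ p + 2 ^ p := by ring
  have e4 : (k + 1 + 1) * 2 ^ p = k * 2 ^ p + 2 ^ p + 2 ^ p := by ring
  have e5 : (k + 1 + 1 + 1) * 2 ^ p = k * 2 ^ p + 2 ^ p + 2 ^ p + 2 ^ p := by ring
  rw [pow_succ] at hp2
  set Q := ((j - i : ℕ) : ℝ) ^ w with hQ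
  have hQ0 : 0 ≤ Q := by positivity
  have tri : ∀ x y z : ℝ, |x| ≤ |x - y - z| + |y| + |z| := by
    intro x y z
    have := abs_add_three (x - y - z) y z
    rwa [show x - y - z + y + z = x by ring] at this
  have hDK : 0 ≤ D * K := mul_nonneg (by linarith) hK
  have hKQ : K * Q ≤ D * K * Q := by
    have : 0 ≤ K * Q := by positivity
    nlinarith
  have hDKp := mul_le_mul_of_nonneg_left hpj hDK
  have t1 := tri (F i j) (F i ((k + 1) * 2 ^ p)) (F ((k + 1) * 2 ^ p) j)
  have t2 := hδ i ((k + 1) * 2 ^ p) j hk2.le (by omega) hj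
  have t3 := left p k i hk2.le (by omega) hk1
  have goal : |F ((k + 1) * 2 ^ p) j| ≤ 3 * (D * K * Q) := by
    rcases le_total j ((k + 1 + 1) * 2 ^ p) with h | h
    · have := right p (k + 1) j (by omega) hj h
      have : 0 ≤ D * K * Q := by positivity
      linarith
    · have s1 := tri (F ((k + 1) * 2 ^ p) j) (F ((k + 1) * 2 ^ p) ((k + 1 + 1) * 2 ^ p))
        (F ((k + 1 + 1) * 2 ^ p) j)
      have s2 := hδ ((k + 1) * 2 ^ p) ((k + 1 + 1) * 2 ^ p) j (by omega) h hj
      have s3 := right p (k + 1) ((k + 1 + 1) * 2 ^ p) (by omega) (by omega) le_rfl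
      have s4 := right p (k + 1 + 1) j h hj (by omega)
      have s5 : ((j - (k + 1) * 2 ^ p : ℕ) : ℝ) ^ w ≤ Q :=
        Real.rpow_le_rpow (by positivity) (by exact_mod_cast (by omega)) hw.le
      have s6 := mul_le_mul_of_nonneg_left s5 hK
      linarith
  have : 5 * D * K * Q = 5 * (D * K * Q) := by ring
  linarith

/-! ### Words of small weight -/

/-- The normalization by `gammaHat` cancels, so lightness of a word depends on its own letters only
and is unaffected by a new letter. -/
lemma mem_lightWords {γ : A → ℝ} (hg : 0 < gammaHat γ) {v : List A} :
    v ∈ lightWords γ ↔ expSum γ v ≤ 1 := by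
  change (v.map γ).sum / gammaHat γ ≤ (gammaHat γ)⁻¹ ↔ (v.map γ).sum ≤ 1
  rw [inv_eq_one_div, div_le_div_iff_of_pos_right hg]

lemma lightWords_perm {γ : A → ℝ} {u v : List A} (h : u.Perm v) :
    u ∈ lightWords γ ↔ v ∈ lightWords γ := by
  simp only [lightWords, weight, mem_ofPred_eq, (h.map γ).sum_eq]

lemma lightWordsUpTo_perm {γ : A → ℝ} {n : ℕ} ⦃u v : List A⦄ (h : u.Perm v) :
    u ∈ lightWordsUpTo γ n ↔ v ∈ lightWordsUpTo γ n := by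
  simp only [lightWordsUpTo, mem_ofPred_eq, lightWords_perm h, h.length_eq]

lemma isLowerWords_lightWords {γ : A → ℝ} (hγ : ∀ a, 0 < γ a) (hg : 0 < gammaHat γ) :
    IsLowerWords (lightWords γ) := fun u v hu hv => by
  rw [mem_lightWords hg] at *
  exact (expSum_le_of_subperm hγ hv).trans hu

lemma isLowerWords_lightWordsUpTo {γ : A → ℝ} (hγ : ∀ a, 0 < γ a) (hg : 0 < gammaHat γ) (n : ℕ) :
    IsLowerWords (lightWordsUpTo γ n) := fun _ _ hu hv =>
  ⟨isLowerWords_lightWords hγ hg hu.1 hv, hv.length_le.trans hu.2⟩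

lemma nil_mem_lightWordsUpTo {γ : A → ℝ} (hg : 0 < gammaHat γ) (n : ℕ) :
    [] ∈ lightWordsUpTo γ n :=
  ⟨(mem_lightWords hg).2 (by simp), by simp⟩

lemma lightWordsUpTo_mono (γ : A → ℝ) {m n : ℕ} (h : m ≤ n) :
    lightWordsUpTo γ m ⊆ lightWordsUpTo γ n := fun _ hv => ⟨hv.1, hv.2.trans h⟩

/-! ### Perturbations by functionals on long words -/

lemma conv_eq_of_proper {f f' g g' : Dual A} (hf : f [] = 0) (hf' : f' [] = 0) (hg : g [] = 0)
    (hg' : g' [] = 0) {v : List A} (hff : ∀ w : List A, w.length < v.length → f w = f' w)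
    (hgg : ∀ w : List A, w.length < v.length → g w = g' w) : conv f g v = conv f' g' v := by
  refine Finset.sum_congr rfl fun i hi => ?_
  have hi' : i ≤ v.length := Nat.le_of_lt_succ (Finset.mem_range.1 hi)
  rcases Nat.eq_zero_or_pos i with rfl | h0
  · simp [hf, hf']
  rcases hi'.eq_or_lt with rfl | h1
  · simp [hg, hg']
  · rw [hff _ (by rw [List.length_take]; omega), hgg _ (by rw [List.length_drop]; omega)]

lemma convPow_add_two_eq {f f' : Dual A} (hf : f [] = 0) (hf' : f' [] = 0) {v : List A}
    (h : ∀ w : List A, w.length < v.length → f w = f' w) (k : ℕ) :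
    convPow f (k + 2) v = convPow f' (k + 2) v := by
  have aux : ∀ (k : ℕ) (w : List A), w.length < v.length →
      convPow f k w = convPow f' k w := by
    intro k
    induction k with
    | zero => exact fun _ _ => rfl
    | succ k ih =>
      intro w hw
      simp only [convPow, conv]
      refine Finset.sum_congr rfl fun i _ => ?_
      rw [h _ (lt_of_le_of_lt (by rw [List.length_take]; omega) hw),
        ih _ (lt_of_le_of_lt (by rw [List.length_drop]; omega) hw)]
  exact conv_eq_of_proper hf hf' (by simp [convPow_nil, hf]) (by simp [convPow_nil, hf'])
    h (aux _)

/-- In a product of two or more factors vanishing on the empty word, each factor sees only words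
shorter than `v`, where `ζ` is invisible. Thus `ζ` enters only through the linear term. -/
lemma expS_add_of_vanish {α ζ : Dual A} (hα : α [] = 0) (hζ : ζ [] = 0) {v : List A}
    (h : ∀ w : List A, w.length < v.length → ζ w = 0) :
    expS (α + ζ) v = expS α v + ζ v := by
  have key : ∀ k, convPow (α + ζ) k v / (k.factorial : ℝ) =
      convPow α k v / (k.factorial : ℝ) + if k = 1 then ζ v else 0 := by
    intro k
    match k with
    | 0 => simp [convPow]
    | 1 => simp [convPow_one]
    | k + 2 =>
      rw [convPow_add_two_eq (f' := α) (by simp [hα, hζ]) hα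
        (fun w hw => by simp [h w hw])]
      simp
  simp only [expS, key, Finset.sum_add_distrib]
  rw [Finset.sum_ite_eq']
  congr 1
  cases v with
  | nil => simp [hζ]
  | cons a v => simp

lemma conv_vanish_left {ζ g : Dual A} {v : List A}
    (h : ∀ w : List A, w.length < v.length → ζ w = 0) : conv ζ g v = ζ v * g [] := by
  rw [conv, Finset.sum_range_succ, Finset.sum_eq_zero, zero_add, List.take_length,
    List.drop_length]
  intro i hi
  rw [h, zero_mul]
  rw [List.length_take]
  exact lt_of_le_of_lt (min_le_left _ _) (Finset.mem_range.1 hi)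

lemma conv_vanish_right {f ζ : Dual A} {v : List A}
    (h : ∀ w : List A, w.length < v.length → ζ w = 0) : conv f ζ v = f [] * ζ v := by
  rw [conv, Finset.sum_range_succ', Finset.sum_eq_zero, zero_add, List.take_zero,
    List.drop_zero]
  intro i hi
  rw [h, mul_zero]
  rw [List.length_drop]
  have := Finset.mem_range.1 hi
  omega

/-! ### Increments of paths of characters -/

/-- Chen's relation for increments. -/
lemma IsCharOn.incr_conv_incr {T : Set (List A)} (hT : IsLowerWords T) {X : Dual A}
    (hX : IsCharOn T X) (Y Z : Dual A) :
    EqOn (AnisoRP.conv (AnisoRP.conv (AnisoRP.inv Y) X) (AnisoRP.conv (AnisoRP.inv X) Z))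
      (AnisoRP.conv (AnisoRP.inv Y) Z) T := by
  have h := conv_congr hT (eqOn_refl (AnisoRP.inv Y) T)
    (conv_congr hT (hX.conv_inv hT) (eqOn_refl Z T))
  rw [counit_conv, conv_assoc] at h
  rw [conv_assoc]
  exact h

lemma IsCharOn.conv_incr {T : Set (List A)} (hT : IsLowerWords T) {X : Dual A}
    (hX : IsCharOn T X) (Z : Dual A) :
    EqOn (AnisoRP.conv X (AnisoRP.conv (AnisoRP.inv X) Z)) Z T := by
  have h := conv_congr hT (hX.conv_inv hT) (eqOn_refl Z T)
  rwa [counit_conv, conv_assoc] at h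

lemma IsCharOn.incr_conv {T : Set (List A)} (hT : IsLowerWords T) {X : Dual A}
    (hX : IsCharOn T X) (Z : Dual A) :
    EqOn (AnisoRP.conv (AnisoRP.inv X) (AnisoRP.conv X Z)) Z T := by
  have h := conv_congr hT (hX.inv_conv hT) (eqOn_refl Z T)
  rwa [counit_conv, conv_assoc] at h

/-- By uniqueness of inverses; it reduces estimates for `s > t` to those for `s < t`. -/
lemma IsCharOn.inv_incr {T : Set (List A)} (hT : IsLowerWords T) (h0 : [] ∈ T) {X Y : Dual A}
    (hX : IsCharOn T X) (hY : IsCharOn T Y) :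
    EqOn (AnisoRP.inv (AnisoRP.conv (AnisoRP.inv X) Y))
      (AnisoRP.conv (AnisoRP.inv Y) X) T := by
  have hG := (hX.inv hT h0).conv hT hY
  have h1 := hX.incr_conv_incr hT Y Y
  have h2 := conv_congr hT ((h1.trans (hY.inv_conv hT)))
    (eqOn_refl (AnisoRP.inv (AnisoRP.conv (AnisoRP.inv X) Y)) T)
  have h3 := conv_congr hT (eqOn_refl (AnisoRP.conv (AnisoRP.inv Y) X) T) (hG.conv_inv hT)
  rw [← conv_assoc, conv_counit] at h3
  rw [counit_conv] at h2
  exact h2.symm.trans h3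

/-! ### The dyadic points -/

lemma dyad_mem {m k : ℕ} (h : k ≤ 2 ^ m) : dyad m k ∈ Icc (0 : ℝ) 1 := by
  refine ⟨by unfold dyad; positivity, ?_⟩
  rw [dyad, div_le_one (by positivity)]
  exact_mod_cast h

lemma dyad_succ_mul (m k : ℕ) : dyad (m + 1) (2 * k) = dyad m k := by
  rw [dyad, dyad, pow_succ]; push_cast; field_simp

lemma dyad_succ_sub (m k : ℕ) : dyad m (k + 1) - dyad m k = ((2 : ℝ) ^ m)⁻¹ := by
  rw [dyad, dyad]; push_cast; field_simp; ring

section Reindex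
variable {ι κ : Type*} {γ : A → ℝ} {S : Set ι} {S' : Set κ} {h : ι → ℝ} {h' : κ → ℝ}
  {T : Set (List A)}

lemma PowBound.reindex {w : ℝ} (hw : 0 ≤ w) {f : ι → ℝ} (hf : PowBound S h w f) (φ : κ → ι)
    (hφ : ∀ j ∈ S', φ j ∈ S) (hh : ∀ j ∈ S', 0 ≤ h (φ j) ∧ h (φ j) ≤ h' j) :
    PowBound S' h' w (fun j => f (φ j)) := by
  obtain ⟨C, hC, H⟩ := hf
  refine ⟨C, hC, fun j hj => (H _ (hφ j hj)).trans ?_⟩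
  have := Real.rpow_le_rpow (hh j hj).1 (hh j hj).2 hw
  gcongr

lemma HomBound.reindex (hγ : ∀ a, 0 < γ a) {f : ι → Dual A} (hf : HomBound γ S h T f) (φ : κ → ι)
    (hφ : ∀ j ∈ S', φ j ∈ S) (hh : ∀ j ∈ S', 0 ≤ h (φ j) ∧ h (φ j) ≤ h' j) :
    HomBound γ S' h' T (fun j => f (φ j)) :=
  fun v hv => (hf v hv).reindex (expSum_nonneg hγ v) φ hφ hh

end Reindex

/-! ### The extension of a path to longer words, on the dyadic points -/

/-- Paths of truncated characters with the regularity of rough paths. -/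
structure IsLevelPath (γ : A → ℝ) (n : ℕ) (X : ℝ → Dual A) : Prop where
  char : ∀ t ∈ Icc (0 : ℝ) 1, IsCharOn (lightWordsUpTo γ n) (X t)
  zero : EqOn (X 0) counit (lightWordsUpTo γ n)
  bound : HomBound γ (Icc (0 : ℝ) 1 ×ˢ Icc (0 : ℝ) 1) (fun p => |p.2 - p.1|)
    (lightWordsUpTo γ n) (fun p => conv (inv (X p.1)) (X p.2))

/-- The indices of the dyadic intervals in `[0,1]`. -/
def dyadicIntervals : Set (ℕ × ℕ) := {p | p.2 < 2 ^ p.1}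

namespace IsLevelPath

variable {γ : A → ℝ} {n : ℕ} {X : ℝ → Dual A}

section
variable (hγ : ∀ a, 0 < γ a) (hg : 0 < gammaHat γ) (hX : IsLevelPath γ n X)
include hγ hg hX

lemma isCharOn_incr {s t : ℝ} (hs : s ∈ Icc (0 : ℝ) 1) (ht : t ∈ Icc (0 : ℝ) 1) :
    IsCharOn (lightWordsUpTo γ n) (conv (inv (X s)) (X t)) :=
  ((hX.char s hs).inv (isLowerWords_lightWordsUpTo hγ hg n) (nil_mem_lightWordsUpTo hg n)).conv
    (isLowerWords_lightWordsUpTo hγ hg n) (hX.char t ht)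

lemma isInfChar_logIncr {s t : ℝ} (hs : s ∈ Icc (0 : ℝ) 1) (ht : t ∈ Icc (0 : ℝ) 1) :
    IsInfChar (logIncr γ n X s t) :=
  (isCharOn_incr hγ hg hX hs ht).isInfChar_indicator_logS
    (isLowerWords_lightWordsUpTo hγ hg n) lightWordsUpTo_perm subset_rfl

lemma homBound_logIncr : HomBound γ (Icc (0 : ℝ) 1 ×ˢ Icc (0 : ℝ) 1) (fun p => |p.2 - p.1|) univ
    (fun p => logIncr γ n X p.1 p.2) :=
  (hX.bound.logS hγ (fun _ _ => abs_nonneg _) (isLowerWords_lightWordsUpTo hγ hg n)).indicator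
    fun _ hv => hv

lemma expS_logIncr {s t : ℝ} (hs : s ∈ Icc (0 : ℝ) 1) (ht : t ∈ Icc (0 : ℝ) 1) :
    EqOn (expS (logIncr γ n X s t)) (conv (inv (X s)) (X t)) (lightWordsUpTo γ n) := by
  have h := expS_congr (isLowerWords_lightWordsUpTo hγ hg n)
    (eqOn_indicator (s := lightWordsUpTo γ n) (f := logS (conv (inv (X s)) (X t))))
  rwa [expS_logS (isCharOn_incr hγ hg hX hs ht).nil] at h

/-- The Baker-Campbell-Hausdorff correction on a dyadic interval. -/
lemma isInfChar_bchHom {m k : ℕ} (hk : k < 2 ^ m) : IsInfChar (bchHom γ (n + 1)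
    (logIncr γ n X (dyad (m + 1) (2 * k)) (dyad (m + 1) (2 * k + 1)))
    (logIncr γ n X (dyad (m + 1) (2 * k + 1)) (dyad (m + 1) (2 * k + 2)))) := by
  have h0 : dyad (m + 1) (2 * k) ∈ Icc (0 : ℝ) 1 := dyad_mem (by rw [pow_succ]; omega)
  have h1 : dyad (m + 1) (2 * k + 1) ∈ Icc (0 : ℝ) 1 := dyad_mem (by rw [pow_succ]; omega)
  have h2 : dyad (m + 1) (2 * k + 2) ∈ Icc (0 : ℝ) 1 := dyad_mem (by rw [pow_succ]; omega)
  have := ((isInfChar_logIncr hγ hg hX h0 h1).isCharOn_expS univ).conv isLowerWords_univ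
    ((isInfChar_logIncr hγ hg hX h1 h2).isCharOn_expS univ)
  refine this.isInfChar_indicator_logS isLowerWords_univ (fun u v h => ?_) (subset_univ _)
  simp only [mem_ofPred_eq, lightWords_perm h, h.length_eq]

lemma isInfChar_zCorr {m k : ℕ} (hk : k < 2 ^ m) : IsInfChar (zCorr γ n X m k) := by
  induction m generalizing k with
  | zero => exact isInfChar_zero
  | succ m ih =>
    have hk' : k / 2 < 2 ^ m := by rw [pow_succ] at hk; omega
    exact ((ih hk').smul _).sub ((isInfChar_bchHom hγ hg hX hk').smul _)

lemma homBound_dyad_logIncr : HomBound γ dyadicIntervals (fun p => ((2 : ℝ) ^ p.1)⁻¹) univ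
    (fun p => logIncr γ n X (dyad p.1 p.2) (dyad p.1 (p.2 + 1))) :=
  (homBound_logIncr hγ hg hX).reindex hγ
    (fun p : ℕ × ℕ => (dyad p.1 p.2, dyad p.1 (p.2 + 1)))
    (fun p (hp : p.2 < 2 ^ p.1) => ⟨dyad_mem hp.le, dyad_mem hp⟩)
    fun p _ => ⟨abs_nonneg _, by
      simp only [dyad_succ_sub]; exact (abs_of_nonneg (by positivity)).le⟩

lemma homBound_bchHom : HomBound γ dyadicIntervals (fun p => ((2 : ℝ) ^ (p.1 + 1))⁻¹) univ
    (fun p => bchHom γ (n + 1)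
      (logIncr γ n X (dyad (p.1 + 1) (2 * p.2)) (dyad (p.1 + 1) (2 * p.2 + 1)))
      (logIncr γ n X (dyad (p.1 + 1) (2 * p.2 + 1)) (dyad (p.1 + 1) (2 * p.2 + 2)))) := by
  have hL := homBound_dyad_logIncr hγ hg hX
  have h1 := hL.reindex hγ (S' := dyadicIntervals) (h' := fun p => ((2 : ℝ) ^ (p.1 + 1))⁻¹)
    (fun p : ℕ × ℕ => (p.1 + 1, 2 * p.2))
    (fun p (hp : p.2 < 2 ^ p.1) => show 2 * p.2 < 2 ^ (p.1 + 1) by rw [pow_succ]; omega)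
    fun p _ => ⟨by positivity, le_rfl⟩
  have h2 := hL.reindex hγ (S' := dyadicIntervals) (h' := fun p => ((2 : ℝ) ^ (p.1 + 1))⁻¹)
    (fun p : ℕ × ℕ => (p.1 + 1, 2 * p.2 + 1))
    (fun p (hp : p.2 < 2 ^ p.1) => show 2 * p.2 + 1 < 2 ^ (p.1 + 1) by rw [pow_succ]; omega)
    fun p _ => ⟨by positivity, le_rfl⟩
  have hh : ∀ p ∈ dyadicIntervals, 0 ≤ ((2 : ℝ) ^ (p.1 + 1))⁻¹ := fun p _ => by positivity
  exact (((h1.expS hγ hh isLowerWords_univ).conv hγ hh isLowerWords_univ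
    (h2.expS hγ hh isLowerWords_univ)).logS hγ hh isLowerWords_univ).indicator fun _ _ => trivial

omit hγ hg hX in
lemma zCorr_eq_zero {v : List A} (hv : ¬ (v ∈ lightWords γ ∧ v.length = n + 1)) (m k : ℕ) :
    zCorr γ n X m k v = 0 := by
  induction m generalizing k with
  | zero => rfl
  | succ m ih =>
    simp only [zCorr, bchHom, Pi.sub_apply, Pi.smul_apply, ih, smul_eq_mul]
    rw [indicator_of_notMem (by exact hv)]; simp

lemma homBound_zCorr (hne : ∀ v, expSum γ v ≠ 1) :
    HomBound γ dyadicIntervals (fun p => ((2 : ℝ) ^ p.1)⁻¹) univ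
      (fun p => zCorr γ n X p.1 p.2) := by
  intro v _
  by_cases hv : v ∈ lightWords γ
  -- Lightness gives `≤ 1`; non-resonance makes it strict, as `halving_bound` requires.
  · have hw : expSum γ v < 1 := lt_of_le_of_ne ((mem_lightWords hg).1 hv) (hne v)
    obtain ⟨B, hB, H⟩ := homBound_bchHom hγ hg hX v trivial
    obtain ⟨C, hC, G⟩ := halving_bound hw (B := 1 / 2 * B) (by positivity)
      (z := fun m k => zCorr γ n X m k v) (fun k => rfl) (by
        intro m k hk
        have hk' : k / 2 < 2 ^ m := by rw [pow_succ] at hk; omega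
        have := H (m, k / 2) hk'
        simp only [zCorr, Pi.sub_apply, Pi.smul_apply, smul_eq_mul]
        refine (abs_sub _ _).trans ?_
        rw [abs_mul, abs_mul, abs_of_nonneg (show (0 : ℝ) ≤ 1 / 2 by norm_num), mul_assoc]
        gcongr)
    exact ⟨C, hC, fun p hp => G p.1 p.2 hp⟩
  · exact powBound_zero.congr fun p _ => (zCorr_eq_zero (fun h => hv h.1) _ _).symm

lemma isCharOn_yIncr {m k : ℕ} (hk : k < 2 ^ m) :
    IsCharOn (lightWordsUpTo γ (n + 1)) (yIncr γ n X m k) :=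
  (((isInfChar_logIncr hγ hg hX (dyad_mem hk.le) (dyad_mem hk)).add
    (isInfChar_zCorr hγ hg hX hk)).isCharOn_expS _).congr
    (isLowerWords_lightWordsUpTo hγ hg _) (nil_mem_lightWordsUpTo hg _) eqOn_indicator.symm

lemma homBound_yIncr (hne : ∀ v, expSum γ v ≠ 1) :
    HomBound γ dyadicIntervals (fun p => ((2 : ℝ) ^ p.1)⁻¹) (lightWordsUpTo γ (n + 1))
      (fun p => yIncr γ n X p.1 p.2) :=
  ((((homBound_dyad_logIncr hγ hg hX).add (homBound_zCorr hγ hg hX hne)).expS hγ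
    (fun p _ => by positivity) isLowerWords_univ).indicator fun _ _ => trivial).mono
    (subset_univ _)

lemma yIncr_apply {m k : ℕ} (hk : k < 2 ^ m) {v : List A} (hv : v ∈ lightWordsUpTo γ (n + 1)) :
    yIncr γ n X m k v =
      expS (logIncr γ n X (dyad m k) (dyad m (k + 1))) v + zCorr γ n X m k v := by
  rw [yIncr, indicator_of_mem hv, expS_add_of_vanish
    (isInfChar_logIncr hγ hg hX (dyad_mem hk.le) (dyad_mem hk)).nil
    (isInfChar_zCorr hγ hg hX hk).nil]
  intro w hw
  have := hv.2
  exact zCorr_eq_zero (fun h => by omega) _ _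

lemma yIncr_eqOn {m k : ℕ} (hk : k < 2 ^ m) :
    EqOn (yIncr γ n X m k) (conv (inv (X (dyad m k))) (X (dyad m (k + 1))))
      (lightWordsUpTo γ n) := by
  intro v hv
  rw [yIncr_apply hγ hg hX hk (lightWordsUpTo_mono γ (Nat.le_succ n) hv),
    zCorr_eq_zero (fun h => by have := hv.2; omega), add_zero]
  exact expS_logIncr hγ hg hX (dyad_mem hk.le) (dyad_mem hk) hv

/-- The increments over the two halves of a dyadic interval multiply to that over the interval. -/
lemma conv_yIncr_yIncr {m k : ℕ} (hk : k < 2 ^ m) :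
    EqOn (conv (yIncr γ n X (m + 1) (2 * k)) (yIncr γ n X (m + 1) (2 * k + 1)))
      (yIncr γ n X m k) (lightWordsUpTo γ (n + 1)) := by
  have hT := isLowerWords_lightWordsUpTo hγ hg n
  have hT' := isLowerWords_lightWordsUpTo hγ hg (n + 1)
  have hk0 : 2 * k < 2 ^ (m + 1) := by rw [pow_succ]; omega
  have hk1 : 2 * k + 1 < 2 ^ (m + 1) := by rw [pow_succ]; omega
  set s := dyad (m + 1) (2 * k) with hs
  set u := dyad (m + 1) (2 * k + 1) with hu
  set t := dyad (m + 1) (2 * k + 2) with ht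
  have hs' : s = dyad m k := dyad_succ_mul m k
  have ht' : t = dyad m (k + 1) := dyad_succ_mul m (k + 1)
  have h0 : s ∈ Icc (0 : ℝ) 1 := dyad_mem hk0.le
  have h1 : u ∈ Icc (0 : ℝ) 1 := dyad_mem hk1.le
  have h2 : t ∈ Icc (0 : ℝ) 1 := dyad_mem hk1
  set L₁ := logIncr γ n X s u with hL₁
  set L₂ := logIncr γ n X u t with hL₂
  set L := logIncr γ n X s t with hL
  set Z := zCorr γ n X m k with hZ
  set B := bchHom γ (n + 1) L₁ L₂ with hB
  have hz0 : zCorr γ n X (m + 1) (2 * k) = (1 / 2 : ℝ) • Z - (1 / 2 : ℝ) • B := by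
    rw [zCorr, show 2 * k / 2 = k by omega]
  have hz1 : zCorr γ n X (m + 1) (2 * k + 1) = (1 / 2 : ℝ) • Z - (1 / 2 : ℝ) • B := by
    rw [zCorr, show (2 * k + 1) / 2 = k by omega]
  have hE : expS (logS (conv (expS L₁) (expS L₂))) = conv (expS L₁) (expS L₂) :=
    expS_logS (by simp)
  -- Up to length `n` this is Chen's relation for `X`; at length `n + 1`, `L` is zero and `B` is by
  -- definition the logarithm.
  have hW : EqOn (logS (conv (expS L₁) (expS L₂))) (L + B) (lightWordsUpTo γ (n + 1)) := by
    intro v hv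
    by_cases hvn : v.length = n + 1
    · have e1 : L v = 0 := indicator_of_notMem (fun h => by have := h.2; omega) _
      have e2 : B v = logS (conv (expS L₁) (expS L₂)) v := indicator_of_mem
        (show v ∈ {v | v ∈ lightWords γ ∧ v.length = n + 1} from ⟨hv.1, hvn⟩) _
      rw [Pi.add_apply, e1, e2, zero_add]
    · have hvT : v ∈ lightWordsUpTo γ n := ⟨hv.1, by have := hv.2; omega⟩
      have e1 : B v = 0 := indicator_of_notMem (fun h => hvn h.2) _
      have e2 : L v = logS (conv (inv (X s)) (X t)) v := indicator_of_mem hvT _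
      rw [Pi.add_apply, e1, e2, add_zero]
      refine logS_congr hT ?_ hvT
      exact (conv_congr hT (expS_logIncr hγ hg hX h0 h1) (expS_logIncr hγ hg hX h1 h2)).trans
        ((hX.char u h1).incr_conv_incr hT _ _)
  have hLn : L [] = 0 := (isInfChar_logIncr hγ hg hX h0 h2).nil
  have hBn : B [] = 0 := (isInfChar_bchHom hγ hg hX hk).nil
  intro v hv
  -- The correction shared by both halves. It vanishes below length `n + 1`, so it enters the
  -- product linearly and `D ⋆ D` drops out.
  set D := (1 / 2 : ℝ) • Z - (1 / 2 : ℝ) • B with hD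
  have hZw : ∀ w : List A, w.length < v.length → Z w = 0 := fun w hw =>
    zCorr_eq_zero (fun h => by have := hv.2; omega) _ _
  have hBw : ∀ w : List A, w.length < v.length → B w = 0 := fun w hw =>
    indicator_of_notMem (fun h => by have h1 := h.2; have h2 := hv.2; omega) _
  have hDw : ∀ w : List A, w.length < v.length → D w = 0 := fun w hw => by
    simp [hD, hZw w hw, hBw w hw]
  have e1 : EqOn (yIncr γ n X (m + 1) (2 * k)) (expS L₁ + D) (lightWordsUpTo γ (n + 1)) :=
    fun w hw => by rw [yIncr_apply hγ hg hX hk0 hw, hz0]; rfl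
  have e2 : EqOn (yIncr γ n X (m + 1) (2 * k + 1)) (expS L₂ + D)
      (lightWordsUpTo γ (n + 1)) :=
    fun w hw => by rw [yIncr_apply hγ hg hX hk1 hw, hz1]; rfl
  have e3 : conv (expS L₁) (expS L₂) v = expS L v + B v := by
    rw [← hE, expS_congr hT' hW hv, expS_add_of_vanish hLn hBn hBw]
  have hDD : conv D D v = 0 := by
    rw [conv_vanish_left hDw]
    have : D [] = 0 := by simp [hD, hBn, hZ, (isInfChar_zCorr hγ hg hX hk).nil]
    rw [this, mul_zero]
  rw [conv_congr hT' e1 e2 hv, yIncr_apply hγ hg hX hk hv, ← hs', ← ht', conv_add_left,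
    conv_add_right, conv_add_right]
  simp only [Pi.add_apply]
  -- What remains is `exp L + B + 2D` at `v`, and `2D = Z - B`.
  rw [e3, hDD, conv_vanish_left hDw, conv_vanish_right hDw, expS_nil, expS_nil]
  simp only [hD, Pi.sub_apply, Pi.smul_apply, smul_eq_mul]
  ring

lemma isCharOn_yPath {m j : ℕ} (hj : j ≤ 2 ^ m) :
    IsCharOn (lightWordsUpTo γ (n + 1)) (yPath γ n X m j) := by
  have hT' := isLowerWords_lightWordsUpTo hγ hg (n + 1)
  induction j with
  | zero => exact isCharOn_counit _
  | succ j ih =>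
    exact ((ih (by omega)).conv hT' (isCharOn_yIncr hγ hg hX hj)).congr hT'
      (nil_mem_lightWordsUpTo hg _) eqOn_indicator.symm

lemma yPath_eqOn {m j : ℕ} (hj : j ≤ 2 ^ m) :
    EqOn (yPath γ n X m j) (X (dyad m j)) (lightWordsUpTo γ n) := by
  have hT := isLowerWords_lightWordsUpTo hγ hg n
  induction j with
  | zero =>
    have : dyad m 0 = 0 := by simp [dyad]
    rw [this]; exact hX.zero.symm
  | succ j ih =>
    have h1 : EqOn (yPath γ n X m (j + 1)) (conv (yPath γ n X m j) (yIncr γ n X m j))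
        (lightWordsUpTo γ n) :=
      EqOn.mono (lightWordsUpTo_mono γ (Nat.le_succ n)) eqOn_indicator
    exact (h1.trans (conv_congr hT (ih (by omega)) (yIncr_eqOn hγ hg hX hj))).trans
      ((hX.char _ (dyad_mem (by omega))).conv_incr hT _)

lemma yPath_succ_mul {m j : ℕ} (hj : j ≤ 2 ^ m) :
    EqOn (yPath γ n X (m + 1) (j * 2)) (yPath γ n X m j) (lightWordsUpTo γ (n + 1)) := by
  have hT' := isLowerWords_lightWordsUpTo hγ hg (n + 1)
  induction j with
  | zero => simp [yPath, eqOn_refl]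
  | succ j ih =>
    have ih := ih (by omega)
    rw [show (j + 1) * 2 = j * 2 + 1 + 1 by ring]
    have h1 : EqOn (yPath γ n X (m + 1) (j * 2 + 1 + 1))
        (conv (conv (yPath γ n X (m + 1) (j * 2)) (yIncr γ n X (m + 1) (j * 2)))
          (yIncr γ n X (m + 1) (j * 2 + 1))) (lightWordsUpTo γ (n + 1)) :=
      EqOn.trans eqOn_indicator (conv_congr hT' eqOn_indicator (eqOn_refl _ _))
    rw [conv_assoc, mul_comm j 2] at h1
    rw [mul_comm j 2] at ih ⊢
    exact (h1.trans (conv_congr hT' ih (conv_yIncr_yIncr hγ hg hX hj))).trans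
      eqOn_indicator.symm

lemma yPath_add_mul {m j : ℕ} (hj : j ≤ 2 ^ m) (p : ℕ) :
    EqOn (yPath γ n X (m + p) (j * 2 ^ p)) (yPath γ n X m j) (lightWordsUpTo γ (n + 1)) := by
  induction p with
  | zero => simp [eqOn_refl]
  | succ p ih =>
    rw [pow_succ, ← mul_assoc, ← add_assoc]
    refine (yPath_succ_mul hγ hg hX ?_).trans ih
    rw [pow_add]; exact Nat.mul_le_mul_right _ hj

end

end IsLevelPath

/-! ### Regularity of the extended path on dyadic points -/

lemma inv_counit : inv (counit : Dual A) = counit := funext fun v => by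
  simpa using (isCharOn_counit univ).inv_conv isLowerWords_univ (mem_univ v)

lemma conv_eq_add_interior (f g : Dual A) {v : List A} {n : ℕ} (hv : v.length = n + 1) :
    conv f g v = f [] * g v + f v * g [] +
      ∑ l ∈ Finset.range n, f (v.take (l + 1)) * g (v.drop (l + 1)) := by
  rw [conv, hv, Finset.sum_range_succ, Finset.sum_range_succ', ← hv]
  simp
  ring

lemma conv_eq_sum_add_last (f g : Dual A) (v : List A) :
    conv f g v = ∑ l ∈ Finset.range v.length, f (v.take l) * g (v.drop l) + f v * g [] := by
  rw [conv, Finset.sum_range_succ]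
  simp

/-- Multiplication with functionals close to the counit changes the values on words little. -/
lemma exists_modulus_conv {ι : Type*} {γ : A → ℝ} (hγ : ∀ a, 0 < γ a) {S : Set ι} {h : ι → ℝ}
    {T : Set (List A)} (hT : IsLowerWords T) {f g : ι → Dual A}
    (hf : HomBound γ S (fun _ => 1) T f) (hg : HomBound γ S h T g) {v : List A} (hv : v ∈ T) :
    ∃ b : ℝ → ℝ, ContinuousAt b 0 ∧ b 0 = 0 ∧
      ∀ i ∈ S, g i [] = 1 → |conv (f i) (g i) v - f i v| ≤ b (h i) := by
  choose C hC H using fun l => hf _ (hT.take hv l)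
  choose D hD G using fun l => hg _ (hT.drop hv l)
  -- After the full prefix is split off, the suffixes are non-empty; their positive exponents make
  -- the modulus vanish at 0.
  have hpos : ∀ l ∈ Finset.range v.length, 0 < expSum γ (v.drop l) := fun l hl =>
    expSum_pos hγ fun h0 => by
      have := List.drop_eq_nil_iff.1 h0
      have := Finset.mem_range.1 hl
      omega
  refine ⟨fun x => ∑ l ∈ Finset.range v.length, C l * (D l * x ^ expSum γ (v.drop l)),
    ?_, ?_, fun i hi h1 => ?_⟩
  · refine tendsto_finsetSum _ fun l hl => ?_
    exact ((Real.continuousAt_rpow_const 0 _ (Or.inr (hpos l hl).le)).const_mul _).const_mul _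
  · refine Finset.sum_eq_zero fun l hl => ?_
    rw [Real.zero_rpow (hpos l hl).ne']; simp
  · rw [conv_eq_sum_add_last, h1, mul_one, add_sub_cancel_right]
    refine (Finset.abs_sum_le_sum_abs _ _).trans (Finset.sum_le_sum fun l _ => ?_)
    rw [abs_mul]
    have h2 := H l i hi
    rw [Real.one_rpow, mul_one] at h2
    exact mul_le_mul h2 (G l i hi) (abs_nonneg _) (hC l)

/-- The pairs of dyadic points of the same generation in `[0,1]`. -/
def dyadicPairs : Set (ℕ × ℕ × ℕ) := {q | q.2.1 ≤ q.2.2 ∧ q.2.2 ≤ 2 ^ q.1}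

lemma dyad_sub_dyad {m i j : ℕ} (h : i ≤ j) :
    dyad m j - dyad m i = ((j - i : ℕ) : ℝ) / 2 ^ m := by
  rw [dyad, dyad, Nat.cast_sub h, sub_div]

namespace IsLevelPath

variable {γ : A → ℝ} {n : ℕ} {X : ℝ → Dual A} (hγ : ∀ a, 0 < γ a) (hg : 0 < gammaHat γ)

include hγ hg

lemma homBound_yPath_of_le (hX : IsLevelPath γ n X) :
    HomBound γ dyadicPairs (fun q => ((q.2.2 - q.2.1 : ℕ) : ℝ) / 2 ^ q.1) (lightWordsUpTo γ n)
      (fun q => conv (inv (yPath γ n X q.1 q.2.1)) (yPath γ n X q.1 q.2.2)) := by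
  have hT := isLowerWords_lightWordsUpTo hγ hg n
  have h := hX.bound.reindex hγ (S' := dyadicPairs)
    (h' := fun q => ((q.2.2 - q.2.1 : ℕ) : ℝ) / 2 ^ q.1)
    (fun q => (dyad q.1 q.2.1, dyad q.1 q.2.2))
    (fun q hq => ⟨dyad_mem (hq.1.trans hq.2), dyad_mem hq.2⟩)
    fun q hq => ⟨abs_nonneg _, by
      simp only [dyad_sub_dyad hq.1]; exact (abs_of_nonneg (by positivity)).le⟩
  refine h.congr fun q hq => ?_
  exact (conv_congr hT (inv_congr hT (yPath_eqOn hγ hg hX (hq.1.trans hq.2)))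
    (yPath_eqOn hγ hg hX hq.2)).symm

/-- Only words of length `n + 1` are new. There, Chen's relation is additive up to values at shorter
words, and increments over dyadic intervals are values of `yIncr`; these are the two inputs of
`chaining_bound`. -/
lemma homBound_yPath (hX : IsLevelPath γ n X) (hne : ∀ v, expSum γ v ≠ 1) :
    HomBound γ dyadicPairs (fun q => ((q.2.2 - q.2.1 : ℕ) : ℝ) / 2 ^ q.1)
      (lightWordsUpTo γ (n + 1))
      (fun q => conv (inv (yPath γ n X q.1 q.2.1)) (yPath γ n X q.1 q.2.2)) := by
  have hlow := homBound_yPath_of_le hγ hg hX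
  have hT' := isLowerWords_lightWordsUpTo hγ hg (n + 1)
  have h0' := nil_mem_lightWordsUpTo hg (n + 1)
  intro v hv
  by_cases hvn : v ∈ lightWordsUpTo γ n
  · exact hlow v hvn
  have hlen : v.length = n + 1 := by
    by_contra h
    exact hvn ⟨hv.1, by have := hv.2; omega⟩
  have hw : 0 < expSum γ v := expSum_pos hγ fun h => by simp [h] at hlen
  set E : ℕ → ℕ → ℕ → Dual A := fun M i j =>
    conv (inv (yPath γ n X M i)) (yPath γ n X M j) with hEdef
  have hE1 : ∀ {M i j}, i ≤ 2 ^ M → j ≤ 2 ^ M → E M i j [] = 1 := fun hi hj =>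
    (((isCharOn_yPath hγ hg hX hi).inv hT' h0').conv hT' (isCharOn_yPath hγ hg hX hj)).nil
  -- The defect of additivity is a sum of products over proper cuts of `v`, each already controlled
  -- at level `n`, with exponents adding up to `expSum γ v`.
  obtain ⟨C₁, hC₁, H₁⟩ : PowBound
      {q : ℕ × ℕ × ℕ × ℕ | q.2.1 ≤ q.2.2.1 ∧ q.2.2.1 ≤ q.2.2.2 ∧ q.2.2.2 ≤ 2 ^ q.1}
      (fun q => ((q.2.2.2 - q.2.1 : ℕ) : ℝ) / 2 ^ q.1) (expSum γ v)
      (fun q => E q.1 q.2.1 q.2.2.2 v - E q.1 q.2.1 q.2.2.1 v - E q.1 q.2.2.1 q.2.2.2 v) := by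
    have hs : PowBound
        {q : ℕ × ℕ × ℕ × ℕ | q.2.1 ≤ q.2.2.1 ∧ q.2.2.1 ≤ q.2.2.2 ∧ q.2.2.2 ≤ 2 ^ q.1}
        (fun q => ((q.2.2.2 - q.2.1 : ℕ) : ℝ) / 2 ^ q.1) (expSum γ v)
        (fun q => ∑ l ∈ Finset.range n, E q.1 q.2.1 q.2.2.1 (v.take (l + 1)) *
          E q.1 q.2.2.1 q.2.2.2 (v.drop (l + 1))) := by
      refine PowBound.sum _ fun l hl => ?_
      have hl := Finset.mem_range.1 hl
      have ht : v.take (l + 1) ∈ lightWordsUpTo γ n :=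
        ⟨(hT'.take hv _).1, by rw [List.length_take]; omega⟩
      have hd : v.drop (l + 1) ∈ lightWordsUpTo γ n :=
        ⟨(hT'.drop hv _).1, by rw [List.length_drop]; omega⟩
      rw [← expSum_take_add_drop γ v (l + 1)]
      refine PowBound.mul (fun q _ => by positivity) (expSum_nonneg hγ _) (expSum_nonneg hγ _)
        ((hlow _ ht).reindex (expSum_nonneg hγ _)
          (fun q : ℕ × ℕ × ℕ × ℕ => (q.1, q.2.1, q.2.2.1))
          (fun q hq => ⟨hq.1, hq.2.1.trans hq.2.2⟩) fun q hq => ⟨by positivity, ?_⟩)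
        ((hlow _ hd).reindex (expSum_nonneg hγ _)
          (fun q : ℕ × ℕ × ℕ × ℕ => (q.1, q.2.2.1, q.2.2.2))
          (fun q hq => ⟨hq.2.1, hq.2.2⟩) fun q hq => ⟨by positivity, ?_⟩)
      · have h1 := hq.2.1
        have : q.2.2.1 - q.2.1 ≤ q.2.2.2 - q.2.1 := by omega
        simp only
        gcongr
      · have h1 := hq.1
        have : q.2.2.2 - q.2.2.1 ≤ q.2.2.2 - q.2.1 := by omega
        simp only
        gcongr
    refine hs.congr fun q hq => ?_
    have h1 : q.2.2.1 ≤ 2 ^ q.1 := hq.2.1.trans hq.2.2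
    have h2 := (isCharOn_yPath hγ hg hX h1).incr_conv_incr hT' (yPath γ n X q.1 q.2.1)
      (yPath γ n X q.1 q.2.2.2) hv
    rw [conv_eq_add_interior _ _ hlen] at h2
    change E q.1 q.2.1 q.2.2.1 [] * E q.1 q.2.2.1 q.2.2.2 v +
      E q.1 q.2.1 q.2.2.1 v * E q.1 q.2.2.1 q.2.2.2 [] + _ = E q.1 q.2.1 q.2.2.2 v at h2
    rw [hE1 (hq.1.trans h1) h1, hE1 h1 hq.2.2] at h2
    rw [← h2]
    ring
  obtain ⟨C₂, hC₂, H₂⟩ := homBound_yIncr hγ hg hX hne v hv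
  obtain ⟨C, hC, H⟩ := chaining_bound hw
  refine ⟨C * (C₁ + C₂), by positivity, fun q hq => ?_⟩
  obtain ⟨M, i, j⟩ := q
  have hscale : ∀ x : ℝ, 0 ≤ x → (x / 2 ^ M) ^ expSum γ v =
      (((2 : ℝ) ^ M)⁻¹) ^ expSum γ v * x ^ expSum γ v := fun x hx => by
    rw [← Real.mul_rpow (by positivity) hx, div_eq_inv_mul]
  have hK : 0 ≤ (((2 : ℝ) ^ M)⁻¹) ^ expSum γ v := by positivity
  -- On the integer grid of generation `M` lengths are measured in units of `2^{-M}`; the unit is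
  -- absorbed into the constant `K`.
  have main := H (2 ^ M) ((C₁ + C₂) * (((2 : ℝ) ^ M)⁻¹) ^ expSum γ v)
    (fun i j => E M i j v) (by positivity) ?_ ?_ i j hq.1 hq.2
  · refine main.trans (le_of_eq ?_)
    simp only
    rw [hscale _ (by positivity)]
    ring
  · intro i j k hij hjk hk
    have := H₁ (M, i, j, k) ⟨hij, hjk, hk⟩
    simp only at this
    rw [hscale _ (by positivity)] at this
    refine this.trans ?_
    rw [mul_assoc]
    gcongr
    linarith
  · intro p k hk
    have hpM : p ≤ M := by
      by_contra h
      have h1 : 2 ^ M < 2 ^ p := Nat.pow_lt_pow_right (by norm_num) (by omega)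
      have h2 : 2 ^ p ≤ (k + 1) * 2 ^ p := Nat.le_mul_of_pos_left _ (Nat.succ_pos k)
      omega
    obtain ⟨m, rfl⟩ : ∃ m, M = m + p := ⟨M - p, by omega⟩
    have hk' : k < 2 ^ m := by
      rw [pow_add] at hk
      exact Nat.le_of_mul_le_mul_right hk (by positivity)
    -- Refinement does not change the path, so the increment may be computed in the generation where
    -- it is a single factor.
    have e : E (m + p) (k * 2 ^ p) ((k + 1) * 2 ^ p) v = yIncr γ n X m k v := by
      have e1 := conv_congr hT' (inv_congr hT' (yPath_add_mul hγ hg hX hk'.le p))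
        (yPath_add_mul hγ hg hX (show k + 1 ≤ 2 ^ m from hk') p)
      have e2 := conv_congr hT' (eqOn_refl (inv (yPath γ n X m k)) _)
        (eqOn_indicator (s := lightWordsUpTo γ (n + 1))
          (f := conv (yPath γ n X m k) (yIncr γ n X m k)))
      exact ((e1.trans e2).trans ((isCharOn_yPath hγ hg hX hk'.le).incr_conv hT' _)) hv
    rw [e]
    refine (H₂ (m, k) hk').trans ?_
    have : (((2 : ℝ) ^ m)⁻¹) ^ expSum γ v =
        (((2 : ℝ) ^ (m + p))⁻¹) ^ expSum γ v * ((2 : ℝ) ^ p) ^ expSum γ v := by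
      rw [← Real.mul_rpow (by positivity) (by positivity)]
      congr 1
      rw [pow_add]; field_simp
    simp only
    rw [this, ← mul_assoc]
    gcongr
    linarith

end IsLevelPath

/-! ### The limit along the dyadic points -/

lemma floor_le_two_pow {t : ℝ} (ht : t ∈ Icc (0 : ℝ) 1) (m : ℕ) : ⌊(2 : ℝ) ^ m * t⌋₊ ≤ 2 ^ m := by
  apply Nat.floor_le_of_le
  push_cast
  exact mul_le_of_le_one_right (by positivity) ht.2

lemma dyad_floor_le {t : ℝ} (ht : t ∈ Icc (0 : ℝ) 1) (m : ℕ) :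
    dyad m ⌊(2 : ℝ) ^ m * t⌋₊ ≤ t := by
  rw [dyad, div_le_iff₀ (by positivity), mul_comm t]
  exact Nat.floor_le (mul_nonneg (by positivity) ht.1)

lemma sub_dyad_floor_le (t : ℝ) (m : ℕ) :
    t - dyad m ⌊(2 : ℝ) ^ m * t⌋₊ ≤ ((2 : ℝ) ^ m)⁻¹ := by
  have := (Nat.lt_floor_add_one ((2 : ℝ) ^ m * t)).le
  rw [dyad, sub_le_iff_le_add, ← one_div, ← add_div, le_div_iff₀ (by positivity)]
  linarith

lemma tendsto_two_pow_inv : Tendsto (fun m : ℕ => ((2 : ℝ) ^ m)⁻¹) atTop (𝓝 0) := by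
  simpa [inv_pow] using
    tendsto_pow_atTop_nhds_zero_of_lt_one (r := (2 : ℝ)⁻¹) (by norm_num) (by norm_num)

lemma tendsto_dyad_floor {t : ℝ} (ht : t ∈ Icc (0 : ℝ) 1) :
    Tendsto (fun m : ℕ => dyad m ⌊(2 : ℝ) ^ m * t⌋₊) atTop (𝓝 t) := by
  have h : Tendsto (fun m : ℕ => t - ((2 : ℝ) ^ m)⁻¹) atTop (𝓝 t) := by
    simpa using tendsto_two_pow_inv.const_sub t
  exact tendsto_of_tendsto_of_tendsto_of_le_of_le h tendsto_const_nhds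
    (fun m => by linarith [sub_dyad_floor_le t m]) (fun m => dyad_floor_le ht m)

lemma floor_mul_two_pow_le {t : ℝ} (ht : t ∈ Icc (0 : ℝ) 1) (m p : ℕ) :
    ⌊(2 : ℝ) ^ m * t⌋₊ * 2 ^ p ≤ ⌊(2 : ℝ) ^ (m + p) * t⌋₊ := by
  apply Nat.le_floor
  have := Nat.floor_le (show 0 ≤ (2 : ℝ) ^ m * t from mul_nonneg (by positivity) ht.1)
  push_cast
  calc (⌊(2 : ℝ) ^ m * t⌋₊ : ℝ) * 2 ^ p ≤ (2 : ℝ) ^ m * t * 2 ^ p := by gcongr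
    _ = _ := by rw [pow_add]; ring

lemma tendsto_pairShuffle {T : Set (List A)} (hT : IsLowerWords T) {f : ℕ → Dual A} {g : Dual A}
    (h : ∀ v ∈ T, Tendsto (fun m => f m v) atTop (𝓝 (g v))) {u v : List A} (huv : u ++ v ∈ T) :
    Tendsto (fun m => pairShuffle (f m) u v) atTop (𝓝 (pairShuffle g u v)) :=
  tendsto_list_sum (shuffle u v) fun w hw => h w (mem_of_mem_shuffle hT huv hw)

lemma tendsto_conv {T : Set (List A)} (hT : IsLowerWords T) {f f' : ℕ → Dual A} {g g' : Dual A}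
    (h : ∀ v ∈ T, Tendsto (fun m => f m v) atTop (𝓝 (g v)))
    (h' : ∀ v ∈ T, Tendsto (fun m => f' m v) atTop (𝓝 (g' v))) {v : List A} (hv : v ∈ T) :
    Tendsto (fun m => conv (f m) (f' m) v) atTop (𝓝 (conv g g' v)) :=
  tendsto_finsetSum _ fun i _ => (h _ (hT.take hv i)).mul (h' _ (hT.drop hv i))

lemma tendsto_inv {T : Set (List A)} (hT : IsLowerWords T) {f : ℕ → Dual A} {g : Dual A}
    (h : ∀ v ∈ T, Tendsto (fun m => f m v) atTop (𝓝 (g v))) {v : List A} (hv : v ∈ T) :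
    Tendsto (fun m => inv (f m) v) atTop (𝓝 (inv g v)) :=
  (h _ (hT.reverse hv)).const_mul _

lemma isCharOn_of_tendsto {T : Set (List A)} (hT : IsLowerWords T) (h0 : [] ∈ T)
    {f : ℕ → Dual A} {g : Dual A} (hf : ∀ m, IsCharOn T (f m))
    (h : ∀ v ∈ T, Tendsto (fun m => f m v) atTop (𝓝 (g v))) : IsCharOn T g where
  nil := tendsto_nhds_unique (h [] h0) (by simp [(hf _).nil])
  mul u v huv := by
    refine tendsto_nhds_unique (tendsto_pairShuffle hT h huv) ?_
    simp only [fun m => (hf m).mul u v huv]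
    exact (h u (hT.left huv)).mul (h v (hT.right huv))

namespace IsLevelPath

variable {γ : A → ℝ} {n : ℕ} {X : ℝ → Dual A} (hγ : ∀ a, 0 < γ a) (hg : 0 < gammaHat γ)

include hγ hg

/-- The dyadic approximation of generation `m` is rewritten in generation `m + p`, where it lies
within `2^{-m}` of the finer one. The increment between them is then close to `ε`, uniformly in `p`,
and the sequence is Cauchy. -/
lemma tendsto_extendLevel (hX : IsLevelPath γ n X) (hne : ∀ v, expSum γ v ≠ 1) {t : ℝ}
    (ht : t ∈ Icc (0 : ℝ) 1) {v : List A} (hv : v ∈ lightWordsUpTo γ (n + 1)) :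
    Tendsto (fun m : ℕ => yPath γ n X m ⌊(2 : ℝ) ^ m * t⌋₊ v) atTop
      (𝓝 (extendLevel γ n X t v)) := by
  have hT' := isLowerWords_lightWordsUpTo hγ hg (n + 1)
  have h0' := nil_mem_lightWordsUpTo hg (n + 1)
  have hB := homBound_yPath hγ hg hX hne
  -- Uniform boundedness: the path is its own increment from 0, where it is `ε`.
  have hf : HomBound γ (univ : Set (ℕ × ℕ)) (fun _ => 1) (lightWordsUpTo γ (n + 1))
      (fun q => yPath γ n X (q.1 + q.2) (⌊(2 : ℝ) ^ q.1 * t⌋₊ * 2 ^ q.2)) := by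
    refine (hB.reindex hγ (fun q : ℕ × ℕ => (q.1 + q.2, 0, ⌊(2 : ℝ) ^ q.1 * t⌋₊ * 2 ^ q.2))
      (fun q _ => ⟨Nat.zero_le _, ?_⟩) fun q _ => ⟨by positivity, ?_⟩).congr fun q _ => ?_
    · exact (floor_mul_two_pow_le ht _ _).trans (floor_le_two_pow ht _)
    · simp only [Nat.sub_zero]
      rw [div_le_one (by positivity)]
      exact_mod_cast (floor_mul_two_pow_le ht _ _).trans (floor_le_two_pow ht _)
    · simp only [yPath, inv_counit, counit_conv]
      exact eqOn_refl _ _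
  have hg' : HomBound γ (univ : Set (ℕ × ℕ)) (fun q => ((2 : ℝ) ^ q.1)⁻¹)
      (lightWordsUpTo γ (n + 1))
      (fun q => conv (inv (yPath γ n X (q.1 + q.2) (⌊(2 : ℝ) ^ q.1 * t⌋₊ * 2 ^ q.2)))
        (yPath γ n X (q.1 + q.2) ⌊(2 : ℝ) ^ (q.1 + q.2) * t⌋₊)) := by
    refine hB.reindex hγ (fun q : ℕ × ℕ => (q.1 + q.2, ⌊(2 : ℝ) ^ q.1 * t⌋₊ * 2 ^ q.2,
      ⌊(2 : ℝ) ^ (q.1 + q.2) * t⌋₊))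
      (fun q _ => ⟨floor_mul_two_pow_le ht _ _, floor_le_two_pow ht _⟩)
      fun q _ => ⟨by positivity, ?_⟩
    simp only
    rw [← dyad_sub_dyad (floor_mul_two_pow_le ht _ _)]
    have h1 : dyad (q.1 + q.2) (⌊(2 : ℝ) ^ q.1 * t⌋₊ * 2 ^ q.2) =
        dyad q.1 ⌊(2 : ℝ) ^ q.1 * t⌋₊ := by
      rw [dyad, dyad, pow_add]; push_cast; field_simp
    rw [h1]
    linarith [dyad_floor_le ht (q.1 + q.2), sub_dyad_floor_le t q.1]
  obtain ⟨b, hb, hb0, hbb⟩ := exists_modulus_conv hγ hT' hf hg' hv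
  refine CauchySeq.tendsto_limUnder (cauchySeq_of_le_tendsto_0' (fun m => b ((2 : ℝ) ^ m)⁻¹) ?_ ?_)
  · intro m m' hm
    obtain ⟨p, rfl⟩ := Nat.exists_eq_add_of_le hm
    have hi : ⌊(2 : ℝ) ^ m * t⌋₊ * 2 ^ p ≤ 2 ^ (m + p) :=
      (floor_mul_two_pow_le ht _ _).trans (floor_le_two_pow ht _)
    have hc := isCharOn_yPath hγ hg hX hi
    have hc' := isCharOn_yPath hγ hg hX (floor_le_two_pow ht (m + p))
    have h := hbb (m, p) trivial ((hc.inv hT' h0').conv hT' hc').nil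
    simp only at h
    rw [hc.conv_incr hT' _ hv, yPath_add_mul hγ hg hX (floor_le_two_pow ht m) p hv] at h
    rw [dist_comm, Real.dist_eq]
    exact h
  · have := hb.tendsto.comp tendsto_two_pow_inv
    rwa [hb0] at this

/-- Continuity of the given path along the dyadic approximations, needed to see that the limit
defining the extension returns the old values on short words. -/
lemma tendsto_dyad (hX : IsLevelPath γ n X) {t : ℝ} (ht : t ∈ Icc (0 : ℝ) 1) {v : List A}
    (hv : v ∈ lightWordsUpTo γ n) :
    Tendsto (fun m : ℕ => X (dyad m ⌊(2 : ℝ) ^ m * t⌋₊) v) atTop (𝓝 (X t v)) := by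
  have hT := isLowerWords_lightWordsUpTo hγ hg n
  have hd : ∀ m, dyad m ⌊(2 : ℝ) ^ m * t⌋₊ ∈ Icc (0 : ℝ) 1 := fun m =>
    dyad_mem (floor_le_two_pow ht m)
  have hzero : (0 : ℝ) ∈ Icc (0 : ℝ) 1 := ⟨le_rfl, zero_le_one⟩
  have hf : HomBound γ (univ : Set ℕ) (fun _ => 1) (lightWordsUpTo γ n)
      (fun m => X (dyad m ⌊(2 : ℝ) ^ m * t⌋₊)) := by
    refine (hX.bound.reindex hγ (fun m : ℕ => (0, dyad m ⌊(2 : ℝ) ^ m * t⌋₊))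
      (fun m _ => ⟨hzero, hd m⟩) fun m _ => ⟨abs_nonneg _, ?_⟩).congr fun m _ => ?_
    · simp only [sub_zero]
      rw [abs_of_nonneg (hd m).1]; exact (hd m).2
    · have h1 := conv_congr hT (inv_congr hT hX.zero)
        (eqOn_refl (X (dyad m ⌊(2 : ℝ) ^ m * t⌋₊)) _)
      rwa [inv_counit, counit_conv] at h1
  have hg' : HomBound γ (univ : Set ℕ) (fun m => ((2 : ℝ) ^ m)⁻¹) (lightWordsUpTo γ n)
      (fun m => conv (inv (X (dyad m ⌊(2 : ℝ) ^ m * t⌋₊))) (X t)) := by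
    refine hX.bound.reindex hγ (fun m : ℕ => (dyad m ⌊(2 : ℝ) ^ m * t⌋₊, t))
      (fun m _ => ⟨hd m, ht⟩) fun m _ => ⟨abs_nonneg _, ?_⟩
    simp only
    rw [abs_of_nonneg (sub_nonneg.2 (dyad_floor_le ht m))]
    exact sub_dyad_floor_le t m
  obtain ⟨b, hb, hb0, hbb⟩ := exists_modulus_conv hγ hT hf hg' hv
  have hlim := hb.tendsto.comp tendsto_two_pow_inv
  rw [hb0] at hlim
  rw [tendsto_iff_dist_tendsto_zero]
  refine squeeze_zero (fun _ => dist_nonneg) (fun m => ?_) hlim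
  have h := hbb m trivial (isCharOn_incr hγ hg hX (hd m) ht).nil
  rw [(hX.char _ (hd m)).conv_incr hT _ hv] at h
  rw [dist_comm, Real.dist_eq]
  exact h

lemma extendLevel_eqOn (hX : IsLevelPath γ n X) (hne : ∀ v, expSum γ v ≠ 1) {t : ℝ}
    (ht : t ∈ Icc (0 : ℝ) 1) : EqOn (extendLevel γ n X t) (X t) (lightWordsUpTo γ n) := by
  intro v hv
  refine tendsto_nhds_unique (tendsto_extendLevel hγ hg hX hne ht
    (lightWordsUpTo_mono γ (Nat.le_succ n) hv)) ?_
  refine (tendsto_dyad hγ hg hX ht hv).congr fun m => ?_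
  exact (yPath_eqOn hγ hg hX (floor_le_two_pow ht m) hv).symm

/-- The extension of a path to words of length `n + 1` has the regularity of rough paths. -/
lemma extendLevel (hX : IsLevelPath γ n X) (hne : ∀ v, expSum γ v ≠ 1) :
    IsLevelPath γ (n + 1) (extendLevel γ n X) := by
  have hT' := isLowerWords_lightWordsUpTo hγ hg (n + 1)
  have h0' := nil_mem_lightWordsUpTo hg (n + 1)
  have hlim := fun t ht v hv => tendsto_extendLevel (v := v) (t := t) hγ hg hX hne ht hv
  have hchar : ∀ t ∈ Icc (0 : ℝ) 1, IsCharOn (lightWordsUpTo γ (n + 1))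
      (AnisoRP.extendLevel γ n X t) := fun t ht =>
    isCharOn_of_tendsto hT' h0'
      (fun m => isCharOn_yPath hγ hg hX (floor_le_two_pow ht m)) (hlim t ht)
  refine ⟨hchar, fun v hv => ?_, fun v hv => ?_⟩
  · refine tendsto_nhds_unique (hlim 0 ⟨le_rfl, zero_le_one⟩ v hv) ?_
    simp [yPath]
  have hw := expSum_nonneg hγ v
  have hle : ∀ v ∈ lightWordsUpTo γ (n + 1), ∃ C : ℝ, 0 ≤ C ∧
      ∀ s ∈ Icc (0 : ℝ) 1, ∀ t ∈ Icc (0 : ℝ) 1, s ≤ t →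
      |conv (inv (AnisoRP.extendLevel γ n X s)) (AnisoRP.extendLevel γ n X t) v| ≤
        C * (t - s) ^ expSum γ v := by
    intro v hv
    obtain ⟨C, hC, H⟩ := homBound_yPath hγ hg hX hne v hv
    refine ⟨C, hC, fun s hs t ht hst => ?_⟩
    have h1 := (tendsto_conv hT' (fun w hw => tendsto_inv hT' (hlim s hs) hw) (hlim t ht) hv).abs
    have h2 : Tendsto (fun m : ℕ =>
        C * (dyad m ⌊(2 : ℝ) ^ m * t⌋₊ - dyad m ⌊(2 : ℝ) ^ m * s⌋₊) ^ expSum γ v) atTop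
        (𝓝 (C * (t - s) ^ expSum γ v)) :=
      (((tendsto_dyad_floor ht).sub (tendsto_dyad_floor hs)).rpow_const
        (Or.inr (expSum_nonneg hγ v))).const_mul C
    refine le_of_tendsto_of_tendsto' h1 h2 fun m => ?_
    have hfl : ⌊(2 : ℝ) ^ m * s⌋₊ ≤ ⌊(2 : ℝ) ^ m * t⌋₊ :=
      Nat.floor_le_floor (by gcongr)
    rw [dyad_sub_dyad hfl]
    exact H (m, _, _) ⟨hfl, floor_le_two_pow ht m⟩
  obtain ⟨C, hC, H⟩ := hle v hv
  obtain ⟨D, hD, G⟩ := hle v.reverse (hT'.reverse hv)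
  refine ⟨C + D, by positivity, fun p hp => ?_⟩
  obtain ⟨s, t⟩ := p
  obtain ⟨hs, ht⟩ := hp
  simp only at hs ht ⊢
  rcases le_total s t with h | h
  · rw [abs_of_nonneg (sub_nonneg.2 h)]
    refine (H s hs t ht h).trans ?_
    have : 0 ≤ (t - s) ^ expSum γ v := Real.rpow_nonneg (sub_nonneg.2 h) _
    nlinarith
  -- For `s > t` the increment is the inverse of the one from `t` to `s`: up to sign its value at
  -- the reversed word, which has the same exponents.
  · rw [← (hchar t ht).inv_incr hT' h0' (hchar s hs) hv, abs_sub_comm,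
      abs_of_nonneg (sub_nonneg.2 h), AnisoRP.inv, abs_mul, abs_pow, abs_neg, abs_one, one_pow,
      one_mul]
    refine (G t ht s hs h).trans ?_
    rw [expSum_perm γ (List.reverse_perm v)]
    have : 0 ≤ (s - t) ^ expSum γ v := Real.rpow_nonneg (sub_nonneg.2 h) _
    nlinarith

end IsLevelPath

/-! ### The construction yields anisotropic geometric rough paths -/

/-- Two non-empty words concatenate to length at least 2, so multiplicativity is only tested against
the empty word; the bound is the Hölder condition. -/
lemma isLevelPath_levelOne {γ : A → ℝ} (hγ : ∀ a, 0 < γ a) {x : A → ℝ → ℝ}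
    (hx : ∀ a, ∃ C : NNReal, HolderOnWith C (γ a).toNNReal (x a) (Icc 0 1)) :
    IsLevelPath γ 1 (levelOne x) := by
  have hlen : ∀ v ∈ lightWordsUpTo γ 1, v = [] ∨ ∃ a, v = [a] := by
    intro v hv
    match v, hv.2 with
    | [], _ => exact Or.inl rfl
    | [a], _ => exact Or.inr ⟨a, rfl⟩
  refine ⟨fun t _ => ⟨rfl, fun u v huv => ?_⟩, fun v hv => ?_, fun v hv => ?_⟩
  · match u, v, huv.2 with
    | [], v, _ => simp [levelOne]
    | u, [], _ => simp [levelOne]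
    | a :: u, b :: v, h => simp at h
  · rcases hlen v hv with rfl | ⟨a, rfl⟩ <;> simp [levelOne, counit]
  · rcases hlen v hv with rfl | ⟨a, rfl⟩
    · exact ⟨1, zero_le_one, fun p _ => by simp [inv, levelOne]⟩
    · obtain ⟨C, hC⟩ := hx a
      refine ⟨C, C.2, fun p hp => ?_⟩
      have h := hC.dist_le hp.2 hp.1
      rw [Real.dist_eq, Real.dist_eq, Real.coe_toNNReal _ (hγ a).le] at h
      rw [expSum_singleton]
      have e : conv (inv (levelOne x p.1)) (levelOne x p.2) [a] = x a p.2 - x a p.1 := by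
        simp [conv, inv, levelOne, Finset.sum_range_succ]
      simp only
      rwa [e]

lemma isLevelPath_levelPath {γ : A → ℝ} (hγ : ∀ a, 0 < γ a) (hg : 0 < gammaHat γ)
    (hne : ∀ v, expSum γ v ≠ 1) {x : A → ℝ → ℝ}
    (hx : ∀ a, ∃ C : NNReal, HolderOnWith C (γ a).toNNReal (x a) (Icc 0 1)) (n : ℕ) :
    IsLevelPath γ (n + 1) (levelPath γ x (n + 1)) := by
  induction n with
  | zero => exact isLevelPath_levelOne hγ hx
  | succ n ih => exact ih.extendLevel hγ hg hne

lemma levelPath_eqOn {γ : A → ℝ} (hγ : ∀ a, 0 < γ a) (hg : 0 < gammaHat γ)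
    (hne : ∀ v, expSum γ v ≠ 1) {x : A → ℝ → ℝ}
    (hx : ∀ a, ∃ C : NNReal, HolderOnWith C (γ a).toNNReal (x a) (Icc 0 1)) {m n : ℕ}
    (hm : 1 ≤ m) (hmn : m ≤ n) {t : ℝ} (ht : t ∈ Icc (0 : ℝ) 1) :
    EqOn (levelPath γ x n t) (levelPath γ x m t) (lightWordsUpTo γ m) := by
  induction n, hmn using Nat.le_induction with
  | base => exact eqOn_refl _ _
  | succ n hmn ih =>
    obtain ⟨k, rfl⟩ : ∃ k, n = k + 1 := ⟨n - 1, by omega⟩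
    exact (((isLevelPath_levelPath hγ hg hne hx k).extendLevel_eqOn hγ hg hne ht).mono
      (lightWordsUpTo_mono γ hmn)).trans ih

/-! ### Finite alphabets and the final level -/

section Finite
variable [Finite A] {γ : A → ℝ}

lemma gammaHat_le (γ : A → ℝ) (a : A) : gammaHat γ ≤ γ a := ciInf_le (finite_range γ).bddBelow a

lemma gammaHat_pos [Nonempty A] (hγ : ∀ a, 0 < γ a) : 0 < gammaHat γ := by
  obtain ⟨a, ha⟩ := exists_eq_ciInf_of_finite (f := γ)
  rw [gammaHat, ← ha]
  exact hγ a

lemma one_le_floor_inv_gammaHat [Nonempty A] (hγ : ∀ a, 0 < γ a) (hγ1 : ∀ a, γ a < 1) :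
    1 ≤ ⌊(gammaHat γ)⁻¹⌋₊ := by
  apply Nat.le_floor
  rw [Nat.cast_one]
  exact (one_le_inv₀ (gammaHat_pos hγ)).2
    ((gammaHat_le γ (Classical.arbitrary A)).trans (hγ1 _).le)

lemma length_mul_gammaHat_le (γ : A → ℝ) (v : List A) : v.length * gammaHat γ ≤ expSum γ v := by
  induction v with
  | nil => simp
  | cons a v ih =>
    simp only [expSum, List.length_cons, List.map_cons, List.sum_cons] at *
    push_cast
    linarith [gammaHat_le γ a]

/-- Every letter contributes at least `gammaHat`, so light words are no longer than the level at
which the construction stops. -/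
lemma lightWordsUpTo_floor (hg : 0 < gammaHat γ) :
    lightWordsUpTo γ ⌊(gammaHat γ)⁻¹⌋₊ = lightWords γ := by
  ext v
  refine ⟨fun h => h.1, fun h => ⟨h, Nat.le_floor ?_⟩⟩
  rw [← one_div, le_div_iff₀ hg]
  exact (length_mul_gammaHat_le γ v).trans ((mem_lightWords hg).1 h)

theorem isAGRP_roughPath [Nonempty A] (hγ : ∀ a, 0 < γ a ∧ γ a < 1) (hne : ∀ v, expSum γ v ≠ 1)
    {x : A → ℝ → ℝ} (hx : ∀ a, ∃ C : NNReal, HolderOnWith C (γ a).toNNReal (x a) (Icc 0 1)) :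
    IsAGRP γ (roughPath γ x) ∧ IsOver (roughPath γ x) x := by
  have hγ0 : ∀ a, 0 < γ a := fun a => (hγ a).1
  have hg := gammaHat_pos hγ0
  have hN := one_le_floor_inv_gammaHat hγ0 fun a => (hγ a).2
  have hT := isLowerWords_lightWords hγ0 hg
  have hTN := lightWordsUpTo_floor hg
  have hnil : [] ∈ lightWords γ := hTN ▸ nil_mem_lightWordsUpTo hg _
  have hX : IsLevelPath γ ⌊(gammaHat γ)⁻¹⌋₊ (levelPath γ x ⌊(gammaHat γ)⁻¹⌋₊) := by
    have := isLevelPath_levelPath hγ0 hg hne hx (⌊(gammaHat γ)⁻¹⌋₊ - 1)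
    rwa [Nat.sub_add_cancel hN] at this
  have hstab := fun t (ht : t ∈ Icc (0 : ℝ) 1) =>
    levelPath_eqOn hγ0 hg hne hx le_rfl hN ht
  have hon : ∀ s t, EqOn (roughPath γ x s t) (conv (inv (levelPath γ x ⌊(gammaHat γ)⁻¹⌋₊ s))
      (levelPath γ x ⌊(gammaHat γ)⁻¹⌋₊ t)) (lightWords γ) := fun s t => eqOn_indicator
  have hoff : ∀ s t v, v ∉ lightWords γ → roughPath γ x s t v = 0 := fun s t v hv =>
    indicator_of_notMem hv _
  have hchar : ∀ t ∈ Icc (0 : ℝ) 1,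
      IsCharOn (lightWords γ) (levelPath γ x ⌊(gammaHat γ)⁻¹⌋₊ t) := by
    have := hX.char
    rwa [hTN] at this
  refine ⟨⟨fun s hs t ht => ?_, fun t ht => ?_, fun s hs u hu t ht => ?_, fun v hv => ?_⟩,
    fun s hs t ht a => ?_⟩
  · have hG := ((hchar s hs).inv hT hnil).conv hT (hchar t ht)
    refine ⟨(lightWords γ).indicator (logS _), ⟨hG.isInfChar_indicator_logS hT
      (fun u v h => lightWords_perm h) subset_rfl, fun v hv => indicator_of_notMem hv _⟩, ?_⟩
    have h := expS_congr hT (eqOn_indicator (s := lightWords γ)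
      (f := logS (conv (inv (levelPath γ x ⌊(gammaHat γ)⁻¹⌋₊ s))
        (levelPath γ x ⌊(gammaHat γ)⁻¹⌋₊ t))))
    rw [expS_logS hG.nil] at h
    exact (indicator_congr h).symm
  · ext v
    by_cases hv : v ∈ lightWords γ
    · rw [hon t t hv, (hchar t ht).inv_conv hT hv]
    · rw [hoff _ _ _ hv]
      cases v with
      | nil => exact absurd hnil hv
      | cons a v => rfl
  · refine indicator_congr fun v hv => ?_
    rw [conv_congr hT (hon s u) (hon u t) hv]
    exact (hchar u hu).incr_conv_incr hT _ _ hv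
  · obtain ⟨C, _, H⟩ := hX.bound v (hTN.symm ▸ hv)
    refine ⟨C, fun s hs t ht => ?_⟩
    have e : gammaHat γ * weight γ v = expSum γ v := mul_div_cancel₀ _ hg.ne'
    rw [hon s t hv, e]
    exact H (s, t) ⟨hs, ht⟩
  · have ha : [a] ∈ lightWords γ :=
      (mem_lightWords hg).2 (by rw [expSum_singleton]; exact (hγ a).2.le)
    have ha1 : [a] ∈ lightWordsUpTo γ 1 := ⟨ha, by simp⟩
    have hs1 : levelPath γ x ⌊(gammaHat γ)⁻¹⌋₊ s [a] = x a s - x a 0 := hstab s hs ha1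
    have ht1 : levelPath γ x ⌊(gammaHat γ)⁻¹⌋₊ t [a] = x a t - x a 0 := hstab t ht ha1
    rw [hon s t ha]
    simp [conv, inv, Finset.sum_range_succ, hs1, ht1, (hchar s hs).nil, (hchar t ht).nil]

end Finite

/-- Translates the non-resonance condition on multiplicities into one on words. -/
lemma expSum_eq_sum_count [Fintype A] [DecidableEq A] (γ : A → ℝ) (v : List A) :
    expSum γ v = ∑ a, γ a * (v.count a : ℝ) := by
  induction v with
  | nil => simp
  | cons b v ih =>
    have : expSum γ (b :: v) = γ b + expSum γ v := by simp [expSum]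
    rw [this, ih]
    simp [List.count_cons, mul_add, Finset.sum_add_distrib, add_comm]

/-! ### Restriction to a smaller alphabet -/

section Restrict

/-- The restriction of a functional to the words over the smaller alphabet. -/
def restrict (f : Dual (Option A)) : Dual A := fun v => f (v.map some)

/-- Prefixes and suffixes of words over `A` are words over `A`, so restriction is a morphism of
convolution algebras. -/
lemma restrict_conv (f g : Dual (Option A)) :
    restrict (conv f g) = conv (restrict f) (restrict g) := by
  ext v; simp [restrict, conv, List.map_take, List.map_drop]

lemma restrict_counit : restrict (counit : Dual (Option A)) = counit := by
  ext v; cases v <;> rfl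

lemma restrict_convPow (f : Dual (Option A)) (k : ℕ) :
    restrict (convPow f k) = convPow (restrict f) k := by
  induction k with
  | zero => exact restrict_counit
  | succ k ih => rw [convPow, restrict_conv, ih]; rfl

lemma restrict_expS (f : Dual (Option A)) : restrict (expS f) = expS (restrict f) := by
  ext v
  simp only [expS, ← restrict_convPow]
  simp [restrict, expS]

lemma restrict_sub (f g : Dual (Option A)) :
    restrict (f - g) = restrict f - restrict g := rfl

lemma restrict_add (f g : Dual (Option A)) :
    restrict (f + g) = restrict f + restrict g := rfl

lemma restrict_smul (c : ℝ) (f : Dual (Option A)) : restrict (c • f) = c • restrict f := rfl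

lemma restrict_logS (f : Dual (Option A)) : restrict (logS f) = logS (restrict f) := by
  ext v
  have e : restrict f - counit = restrict (f - counit) := by rw [restrict_sub, restrict_counit]
  simp only [logS, e, ← restrict_convPow]
  simp [restrict, logS]

lemma restrict_inv (f : Dual (Option A)) : restrict (inv f) = inv (restrict f) := by
  ext v; simp [restrict, inv]

lemma restrict_indicator {S : Set (List (Option A))} {T : Set (List A)}
    (h : ∀ v : List A, v.map some ∈ S ↔ v ∈ T) (f : Dual (Option A)) :
    restrict (S.indicator f) = T.indicator (restrict f) := by
  classical
  ext v
  simp only [restrict, indicator_apply, h]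

variable {γ : A → ℝ} {γb : ℝ} (hg : 0 < gammaHat γ) (hg' : 0 < gammaHat (addLetter γ γb))
include hg hg'

lemma map_some_mem_lightWords (v : List A) :
    v.map some ∈ lightWords (addLetter γ γb) ↔ v ∈ lightWords γ := by
  rw [mem_lightWords hg, mem_lightWords hg']
  simp [expSum, Function.comp_def, addLetter]

lemma map_some_mem_lightWordsUpTo (n : ℕ) (v : List A) :
    v.map some ∈ lightWordsUpTo (addLetter γ γb) n ↔ v ∈ lightWordsUpTo γ n := by
  simp [lightWordsUpTo, map_some_mem_lightWords hg hg']

lemma restrict_logIncr (n : ℕ) {X' : ℝ → Dual (Option A)} {X : ℝ → Dual A}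
    (h : ∀ t, restrict (X' t) = X t) (s t : ℝ) :
    restrict (logIncr (addLetter γ γb) n X' s t) = logIncr γ n X s t := by
  rw [logIncr, logIncr, restrict_indicator (map_some_mem_lightWordsUpTo hg hg' n),
    restrict_logS, restrict_conv, restrict_inv, h, h]

lemma restrict_bchHom (n : ℕ) (α β : Dual (Option A)) :
    restrict (bchHom (addLetter γ γb) n α β) = bchHom γ n (restrict α) (restrict β) := by
  rw [bchHom, bchHom, ← restrict_expS, ← restrict_expS, ← restrict_conv, ← restrict_logS]
  exact restrict_indicator (by simp [map_some_mem_lightWords hg hg']) _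

lemma restrict_zCorr (n : ℕ) {X' : ℝ → Dual (Option A)} {X : ℝ → Dual A}
    (h : ∀ t, restrict (X' t) = X t) (m k : ℕ) :
    restrict (zCorr (addLetter γ γb) n X' m k) = zCorr γ n X m k := by
  induction m generalizing k with
  | zero => rfl
  | succ m ih =>
    rw [zCorr, zCorr, restrict_sub, restrict_smul, restrict_smul, ih, restrict_bchHom hg hg',
      restrict_logIncr hg hg' n h, restrict_logIncr hg hg' n h]

lemma restrict_yPath (n : ℕ) {X' : ℝ → Dual (Option A)} {X : ℝ → Dual A}
    (h : ∀ t, restrict (X' t) = X t) (m j : ℕ) :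
    restrict (yPath (addLetter γ γb) n X' m j) = yPath γ n X m j := by
  have hT := map_some_mem_lightWordsUpTo hg hg' (n + 1)
  induction j with
  | zero => exact restrict_counit
  | succ j ih =>
    rw [yPath, yPath, yIncr, yIncr, restrict_indicator hT, restrict_conv, ih,
      restrict_indicator hT, restrict_expS, restrict_add, restrict_logIncr hg hg' n h,
      restrict_zCorr hg hg' n h]

/-- The sequences under `limUnder` agree term by term, so convergence is not needed, and the
identity holds at every level and every real `t`. -/
lemma restrict_levelPath (x : A → ℝ → ℝ) (xb : ℝ → ℝ) (n : ℕ) (t : ℝ) :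
    restrict (levelPath (addLetter γ γb) (addLetter x xb) n t) = levelPath γ x n t := by
  induction n using Nat.strong_induction_on generalizing t with
  | _ n ih =>
    match n with
    | 0 => exact restrict_counit
    | 1 =>
      ext v
      match v with
      | [] => rfl
      | [a] => rfl
      | a :: b :: v => rfl
    | n + 2 =>
      ext v
      have := fun m => congrFun (restrict_yPath hg hg' (n + 1)
        (fun t => ih (n + 1) (Nat.lt_succ_self _) t) m ⌊(2 : ℝ) ^ m * t⌋₊) v
      simp only [levelPath, extendLevel, ← this]
      rfl

end Restrict

end AnisoRP

/-! ### The theorem -/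

theorem mainTheorem6 {A : Type*} [Fintype A] [Nonempty A]
    (γ : A → ℝ) (γb : ℝ) (x : A → ℝ → ℝ) (xb : ℝ → ℝ)
    (hγ : ∀ a, 0 < γ a ∧ γ a < 1) (hγb : 0 < γb ∧ γb < 1)
    (hne : ∀ (k : A → ℕ) (kb : ℕ), (∑ a, γ a * (k a : ℝ)) + γb * (kb : ℝ) ≠ 1)
    (hx : ∀ a, ∃ C : NNReal, HolderOnWith C (γ a).toNNReal (x a) (Set.Icc 0 1))
    (hxb : ∃ C : NNReal, HolderOnWith C γb.toNNReal xb (Set.Icc 0 1)) :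
    -- the construction over `A` yields an anisotropic geometric rough path over the `x^a`
    (AnisoRP.IsAGRP γ (AnisoRP.roughPath γ x) ∧ AnisoRP.IsOver (AnisoRP.roughPath γ x) x) ∧
    -- and so does the construction over `A ∪ {b}`
    (AnisoRP.IsAGRP (AnisoRP.addLetter γ γb)
        (AnisoRP.roughPath (AnisoRP.addLetter γ γb) (AnisoRP.addLetter x xb)) ∧
      AnisoRP.IsOver
        (AnisoRP.roughPath (AnisoRP.addLetter γ γb) (AnisoRP.addLetter x xb))
        (AnisoRP.addLetter x xb)) ∧
    -- the second restricts to the first on the words over `A`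
    ∀ s ∈ Set.Icc (0 : ℝ) 1, ∀ t ∈ Set.Icc (0 : ℝ) 1, ∀ v : List A,
      AnisoRP.roughPath (AnisoRP.addLetter γ γb) (AnisoRP.addLetter x xb) s t (v.map some) =
        AnisoRP.roughPath γ x s t v := by
  classical
  have hγ0 : ∀ a, 0 < γ a := fun a => (hγ a).1
  have hγ' : ∀ a, 0 < AnisoRP.addLetter γ γb a ∧ AnisoRP.addLetter γ γb a < 1 := by
    rintro (_ | a)
    exacts [hγb, hγ a]
  have hx' : ∀ a, ∃ C : NNReal, HolderOnWith C (AnisoRP.addLetter γ γb a).toNNReal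
      (AnisoRP.addLetter x xb a) (Set.Icc 0 1) := by
    rintro (_ | a)
    exacts [hxb, hx a]
  have hne0 : ∀ v, AnisoRP.expSum γ v ≠ 1 := fun v => by
    -- Non-resonance over `A` is the case in which the new letter does not occur.
    have := hne (fun a => v.count a) 0
    rwa [Nat.cast_zero, mul_zero, add_zero, ← AnisoRP.expSum_eq_sum_count] at this
  have hne' : ∀ v, AnisoRP.expSum (AnisoRP.addLetter γ γb) v ≠ 1 := fun v => by
    rw [AnisoRP.expSum_eq_sum_count, Fintype.sum_option, add_comm]
    exact hne _ _
  have hg := AnisoRP.gammaHat_pos hγ0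
  have hg' := AnisoRP.gammaHat_pos fun a => (hγ' a).1
  refine ⟨AnisoRP.isAGRP_roughPath hγ hne0 hx, AnisoRP.isAGRP_roughPath hγ' hne' hx',
    fun s hs t ht v => ?_⟩
  -- A new letter can only lower the minimal exponent, so the larger alphabet needs at least as many
  -- levels. After restriction both paths are over `A`, at these two levels, and `hstab` compares
  -- them.
  have hle : ⌊(AnisoRP.gammaHat γ)⁻¹⌋₊ ≤ ⌊(AnisoRP.gammaHat (AnisoRP.addLetter γ γb))⁻¹⌋₊ :=
    Nat.floor_le_floor (inv_anti₀ hg'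
      (le_ciInf fun a => AnisoRP.gammaHat_le (AnisoRP.addLetter γ γb) (some a)))
  have hT := AnisoRP.isLowerWords_lightWords hγ0 hg
  have hstab : ∀ r ∈ Set.Icc (0 : ℝ) 1, Set.EqOn
      (AnisoRP.levelPath γ x ⌊(AnisoRP.gammaHat (AnisoRP.addLetter γ γb))⁻¹⌋₊ r)
      (AnisoRP.levelPath γ x ⌊(AnisoRP.gammaHat γ)⁻¹⌋₊ r) (AnisoRP.lightWords γ) := fun r hr => by
    rw [← AnisoRP.lightWordsUpTo_floor hg]
    exact AnisoRP.levelPath_eqOn hγ0 hg hne0 hx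
      (AnisoRP.one_le_floor_inv_gammaHat hγ0 fun a => (hγ a).2) hle hr
  change AnisoRP.restrict (AnisoRP.roughPath _ _ s t) v = _
  rw [AnisoRP.roughPath, AnisoRP.starA,
    AnisoRP.restrict_indicator (AnisoRP.map_some_mem_lightWords hg hg'), AnisoRP.restrict_conv,
    AnisoRP.restrict_inv, AnisoRP.restrict_levelPath hg hg', AnisoRP.restrict_levelPath hg hg']
  exact congrFun (Set.indicator_congr (AnisoRP.conv_congr hT
    (AnisoRP.inv_congr hT (hstab s hs)) (hstab t ht))) v
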